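/- Let $\beta,\sigma,r>0$, $\kappa\in\mathbb R$ with $2\kappa<r$, $\mu_0\in\mathbb R$ and $\sigma_0\ge 0$. On a probability space let $Z$ be a standard Brownian motion, let $\theta_0\sim N(\mu_0,\sigma_0^2)$ be independent of $Z$, let $\theta=(\theta_t)_{t\ge0}$ be the continuous solution of $d\theta_t=\kappa\theta_t\,dt+\sigma\,dZ_t$ started at $\theta_0$, and let $Y$ be a standard Brownian motion independent of $\theta$. A decision rule is a real-valued process $A=(A_t)_{t\ge0}$ with right-continuous sample paths such that $A_t$ is measurable with respect to $\sigma(Y)\vee\sigma(\theta_s:s\le t)$ for every $t\ge 0$. For a decision rule $A$ put $\mathcal F^A_t=\sigma(A_s:s\le t)$, and define its bias and variance processes by $B_t=A_t-\mathbf E[\theta_t\mid\mathcal F^A_t]$ and $V_t=\operatorname{Var}(\theta_t\mid\mathcal F^A_t)$. The utilities of the sender and of the receiver from $A$ are $$u_S(A)=-\mathbf E\int_0^\infty re^{-rt}(A_t-\theta_t-\beta)^2\,dt,\qquad u_R(A)=-\mathbf E\int_0^\infty re^{-rt}(A_t-\theta_t)^2\,dt$$ in $[-\infty,0]$. The decision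 rule $A$ is obedient if for every $t\ge0$, almost surely, $$-\mathbf E\Big[\int_t^\infty re^{-r(s-t)}(A_s-\theta_s)^2\,ds\,\Big|\,\mathcal F^A_t\Big]\ \ge\ -\frac{\sigma^2+r\operatorname{Var}(\theta_t\mid\mathcal F^A_t)}{r-2\kappa}.$$ Proposition 2 (Deterministic bias and variance). For every obedient decision rule $A$ there is an obedient decision rule $A'$ with deterministic bias and variance (that is, there are functions $b,v:[0,\infty)\to\mathbb R$ such that for every $t\ge0$ the bias and variance of $A'$ at time $t$ are almost surely equal to $b(t)$ and $v(t)$) such that $u_S(A')\ge u_S(A)$ and $u_R(A')\ge u_R(A)$. -/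

import Mathlib

open MeasureTheory ProbabilityTheory Set
open scoped NNReal ENNReal

namespace BiasVariance

/-- The stochastic environment. `Z` is the driving standard Brownian motion, `θ` is the state
process, `Y` is the sender's randomization device. The state starts from
`θ₀ ∼ N(μ₀, σ₀²)`, independent of `Z`, has continuous paths, and solves
`dθ = κ θ dt + σ dZ` (in integrated form; the noise is additive, so that no stochastic integral
is needed). `Y` is a standard Brownian motion independent of the whole process `θ`. -/
structure IsEnvironment {Ω : Type*} [MeasurableSpace Ω] (P : Measure Ω) (κ σ μ₀ : ℝ) (σ₀ : ℝ≥0)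
    (Z Y θ : ℝ≥0 → Ω → ℝ) : Prop where
  measurable_Z : ∀ t, Measurable (Z t)
  brownian_Z : IsBrownianReal Z P
  measurable_θ : ∀ t, Measurable (θ t)
  continuous_θ : ∀ ω, Continuous fun t ↦ θ t ω
  law_θ_zero : HasLaw (θ 0) (gaussianReal μ₀ (σ₀ ^ 2)) P
  indep_θ_zero_Z : IndepFun (θ 0) (fun ω t ↦ Z t ω) P
  sde : ∀ᵐ ω ∂P, ∀ t : ℝ≥0,
    θ t ω = θ 0 ω + κ * (∫ s in (0 : ℝ)..t, θ s.toNNReal ω) + σ * Z t ω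
  measurable_Y : ∀ t, Measurable (Y t)
  continuous_Y : ∀ ω, Continuous fun t ↦ Y t ω
  brownian_Y : IsBrownianReal Y P
  indep_Y_θ : IndepFun (fun ω t ↦ Y t ω) (fun ω t ↦ θ t ω) P

/-- The history `σ(X_s : s ≤ t)` of a real-valued process `X` up to time `t`. For an action
process `A` this is the receiver's information when he follows action recommendations. -/
def history {Ω : Type*} (X : ℝ≥0 → Ω → ℝ) (t : ℝ≥0) : MeasurableSpace Ω :=
  ⨆ s : ℝ≥0, ⨆ _ : s ≤ t, MeasurableSpace.comap (X s) inferInstance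

/-- The sender's exogenous information at time `t`: the whole randomization device `Y` and the
states up to time `t`. -/
def senderInfo {Ω : Type*} (Y θ : ℝ≥0 → Ω → ℝ) (t : ℝ≥0) : MeasurableSpace Ω :=
  (⨆ u : ℝ≥0, MeasurableSpace.comap (Y u) inferInstance) ⊔ history θ t

/-- A decision rule: a real-valued process with right-continuous sample paths that is adapted to
the sender's exogenous information. -/
structure IsDecisionRule {Ω : Type*} (Y θ A : ℝ≥0 → Ω → ℝ) : Prop where
  adapted : ∀ t, Measurable[senderInfo Y θ t] (A t)
  rightContinuous : ∀ ω t, ContinuousWithinAt (fun s ↦ A s ω) (Ici t) t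

/-- Flow utility of the sender, with bias `β`. -/
def senderFlow (β a x : ℝ) : ℝ := -(a - x - β) ^ 2

/-- Flow utility of the receiver. -/
def receiverFlow (a x : ℝ) : ℝ := -(a - x) ^ 2

/-- Expected discounted utility `E ∫₀^∞ r e^{-rt} u(A_t, θ_t) dt ∈ [-∞, 0]` of a decision rule,
for a flow utility `u ≤ 0`; it is minus the Lebesgue integral of the nonnegative loss. -/
noncomputable def utility {Ω : Type*} [MeasurableSpace Ω] (P : Measure Ω) (r : ℝ)
    (θ : ℝ≥0 → Ω → ℝ) (u : ℝ → ℝ → ℝ) (A : ℝ≥0 → Ω → ℝ) : EReal :=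
  -((∫⁻ ω, (∫⁻ t in Ici (0 : ℝ),
      ENNReal.ofReal (r * Real.exp (-r * t) * -u (A t.toNNReal ω) (θ t.toNNReal ω))) ∂P : ℝ≥0∞) :
    EReal)

/-- The receiver's realized continuation loss `∫_t^∞ r e^{-r(s-t)} (A_s - θ_s)² ds ∈ [0, ∞]`. -/
noncomputable def continuationLoss {Ω : Type*} (r : ℝ) (θ A : ℝ≥0 → Ω → ℝ) (t : ℝ≥0) (ω : Ω) :
    ℝ≥0∞ :=
  ∫⁻ s in Ici (t : ℝ),
    ENNReal.ofReal (r * Real.exp (-r * (s - t)) * (A s.toNNReal ω - θ s.toNNReal ω) ^ 2)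

/-- The bias process `B_t = A_t - E[θ_t | F_t^A]`. -/
noncomputable def bias {Ω : Type*} [MeasurableSpace Ω] (P : Measure Ω) (θ A : ℝ≥0 → Ω → ℝ)
    (t : ℝ≥0) : Ω → ℝ :=
  A t - P[θ t | history A t]

/-- The variance process `V_t = Var(θ_t | F_t^A)`. -/
noncomputable def postVar {Ω : Type*} [MeasurableSpace Ω] (P : Measure Ω) (θ A : ℝ≥0 → Ω → ℝ)
    (t : ℝ≥0) : Ω → ℝ :=
  Var[θ t; P | history A t]

/-- Obedience: at each time `t`, almost surely, the expected continuation loss given the history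
of actions is at most the loss `(σ² + r Var(θ_t | F_t^A)) / (r - 2κ)` from deviating to myopic
play without further information. The conditional expectation is that of a `[0, ∞]`-valued
random variable. -/
def IsObedient {Ω : Type*} [MeasurableSpace Ω] (P : Measure Ω) (κ σ r : ℝ)
    (θ A : ℝ≥0 → Ω → ℝ) : Prop :=
  ∀ t : ℝ≥0, condLExp (history A t) P (continuationLoss r θ A t) ≤ᵐ[P]
    fun ω ↦ ENNReal.ofReal ((σ ^ 2 + r * postVar P θ A t ω) / (r - 2 * κ))

/-- The bias and variance processes are deterministic: they are given by functions of time. -/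
def HasDeterministicBiasVariance {Ω : Type*} [MeasurableSpace Ω] (P : Measure Ω)
    (θ A : ℝ≥0 → Ω → ℝ) : Prop :=
  ∃ b v : ℝ≥0 → ℝ, ∀ t : ℝ≥0,
    (∀ᵐ ω ∂P, bias P θ A t ω = b t) ∧ (∀ᵐ ω ∂P, postVar P θ A t ω = v t)

end BiasVariance

/-!
Only the information that a decision rule releases and the size of its bias matter for payoffs, and
both can be made deterministic.

*Information.* The discounted state `x_t = e^{-κt} θ_t` has increments that are independent of all
the sender knows (`IsEnvironment.indep_increment`). Hence, if `S t` is the variance of `x_t` and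
`q t` the expected conditional variance of `x_t` given the actions so far (`residualVar`), the
released information `p = S - q` is nondecreasing with `0 ≤ p ≤ S` (`IsSignal.monotone_information`).
Conversely every right-continuous such `p` is released with a deterministic conditional variance by
disclosing the state with a delay: reveal `x` up to the time `τ t ≤ t` with `S (τ t) = p t`. While
`p t` is below the initial variance `σ₀²` there is no such time; the clock then runs on `[-1, 0]`,
where a Brownian bridge built from `Y` and ending in `θ₀` reveals the initial state gradually
(`signal`, `exists_clock`, `clockRule`). The history of `A` need not be right-continuous, so `p` is
replaced by its right limit. This only lowers the variance, and the obedience constraint survives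
because the tail of the loss is continuous in time.

*Bias.* At each time replace the random bias `B` by the constant `min (‖B‖₂, β)`. By Jensen's and
the Cauchy-Schwarz inequality neither player loses (`cappedBias_loss_le`). This function of time
need not be right-continuous either; its decreasing rearrangement with respect to `r e^{-rt} dt` is,
has the same law and therefore the same payoffs, and has smaller tails, so obedience is preserved
(`exists_decreasing_rearrangement`). The cap `β` is what keeps the rearrangement finite at time `0`.

*Obedience.* In expectation, the obedience constraint of `A` bounds each tail of the mean loss by a
function of the mean variance, and for the new rule, whose conditional losses are deterministic
(`IsSignal.setLIntegral_clockRule`), the same bound is obedience itself.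
-/

namespace BiasVariance

/-! ### Independence, conditional expectation and joint measurability -/


/-- If `m₂` and `m₃` are independent and `m₁` is independent of the two together, then `m₁` and `m₂`
together are independent of `m₃`. -/
theorem indep_sup_left_of_indep {Ω : Type*} {m₁ m₂ m₃ : MeasurableSpace Ω} [mΩ : MeasurableSpace Ω]
    {P : Measure Ω} [IsProbabilityMeasure P] (h₁ : m₁ ≤ mΩ) (h₂ : m₂ ≤ mΩ) (h₃ : m₃ ≤ mΩ)
    (h : Indep m₁ (m₂ ⊔ m₃) P) (h' : Indep m₂ m₃ P) : Indep (m₁ ⊔ m₂) m₃ P := by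
  let C : Set (Set Ω) := {u | ∃ s t, MeasurableSet[m₁] s ∧ MeasurableSet[m₂] t ∧ u = s ∩ t}
  have hgen : m₁ ⊔ m₂ = MeasurableSpace.generateFrom C := by
    apply le_antisymm
    · refine sup_le (fun s hs ↦ ?_) (fun s hs ↦ ?_)
      · exact MeasurableSpace.measurableSet_generateFrom
          ⟨s, univ, hs, MeasurableSet.univ, (inter_univ s).symm⟩
      · exact MeasurableSpace.measurableSet_generateFrom
          ⟨univ, s, MeasurableSet.univ, hs, (univ_inter s).symm⟩
    · refine MeasurableSpace.generateFrom_le ?_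
      rintro _ ⟨s, t, hs, ht, rfl⟩
      exact MeasurableSet.inter (le_sup_left (a := m₁) (b := m₂) s hs)
        (le_sup_right (a := m₁) (b := m₂) t ht)
  have hpi : IsPiSystem C := by
    rintro _ ⟨s, t, hs, ht, rfl⟩ _ ⟨s', t', hs', ht', rfl⟩ -
    refine ⟨s ∩ s', t ∩ t', MeasurableSet.inter hs hs', MeasurableSet.inter ht ht', ?_⟩
    ext; simp; tauto
  refine IndepSets.indep (sup_le h₁ h₂) h₃ hpi (@MeasurableSpace.isPiSystem_measurableSet _ m₃)
    hgen (@MeasurableSpace.generateFrom_measurableSet _ m₃).symm ?_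
  rw [IndepSets_iff]
  rintro _ u ⟨s, t, hs, ht, rfl⟩ hu
  have hu : MeasurableSet[m₃] u := hu
  rw [Indep_iff] at h h'
  have e1 := h s (t ∩ u) hs (MeasurableSet.inter (le_sup_left (a := m₂) (b := m₃) t ht)
        (le_sup_right (a := m₂) (b := m₃) u hu))
  have e2 := h s t hs (le_sup_left (a := m₂) (b := m₃) t ht)
  rw [inter_assoc, e1, e2, h' t u ht hu, mul_assoc]

theorem indep_sup_right_of_indep {Ω : Type*} {m₁ m₂ m₃ : MeasurableSpace Ω}
    [mΩ : MeasurableSpace Ω]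
    {P : Measure Ω} [IsProbabilityMeasure P] (h₁ : m₁ ≤ mΩ) (h₂ : m₂ ≤ mΩ) (h₃ : m₃ ≤ mΩ)
    (h : Indep (m₁ ⊔ m₂) m₃ P) (h' : Indep m₁ m₂ P) : Indep m₁ (m₂ ⊔ m₃) P := by
  rw [sup_comm]
  exact (indep_sup_left_of_indep h₃ h₂ h₁ (by rw [sup_comm]; exact h.symm) h'.symm).symm

/-- Pythagoras for the conditional expectation: among square-integrable `m`-measurable predictors
`h` of `f`, the mean squared error splits into the distance of `h` to `E[f | m]` and the expected
conditional variance. -/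
theorem integral_sub_sq_eq_add {Ω : Type*} {m mΩ : MeasurableSpace Ω} {P : Measure Ω}
    [IsProbabilityMeasure P] (hm : m ≤ mΩ) {f h : Ω → ℝ} (hf : MemLp f 2 P) (hh : MemLp h 2 P)
    (hhm : StronglyMeasurable[m] h) :
    ∫ ω, (h ω - f ω) ^ 2 ∂P =
      ∫ ω, (h ω - (P[f | m]) ω) ^ 2 ∂P + ∫ ω, (f ω - (P[f | m]) ω) ^ 2 ∂P := by
  have hc : MemLp (P[f | m]) 2 P := hf.condExp (by norm_num)
  have h1 : MemLp (h - P[f | m]) 2 P := hh.sub hc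
  have h2 : MemLp (f - P[f | m]) 2 P := hf.sub hc
  have h0 : ∫ ω, (h ω - (P[f | m]) ω) * (f ω - (P[f | m]) ω) ∂P = 0 := by
    have e1 : P[(h - P[f | m]) * (f - P[f | m]) | m] =ᵐ[P]
        (h - P[f | m]) * P[f - P[f | m] | m] :=
      condExp_mul_of_stronglyMeasurable_left (hhm.sub stronglyMeasurable_condExp)
        (h1.integrable_mul h2) (h2.integrable (by norm_num))
    have e2 : P[f - P[f | m] | m] =ᵐ[P] 0 := by
      have := condExp_sub (m := m) (hf.integrable (by norm_num)) (hc.integrable (by norm_num))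
      refine this.trans ?_
      rw [condExp_of_stronglyMeasurable hm stronglyMeasurable_condExp integrable_condExp]
      simp
    have e3 : P[(h - P[f | m]) * (f - P[f | m]) | m] =ᵐ[P] 0 := by
      filter_upwards [e1, e2] with ω a b
      rw [a]; simp [b]
    rw [← integral_condExp hm (f := fun ω ↦ (h ω - (P[f | m]) ω) * (f ω - (P[f | m]) ω))]
    rw [show (fun ω ↦ (h ω - (P[f | m]) ω) * (f ω - (P[f | m]) ω)) =
      (h - P[f | m]) * (f - P[f | m]) from rfl, integral_congr_ae e3]
    simp
  have i1 : Integrable (fun ω ↦ (h ω - (P[f | m]) ω) ^ 2) P := h1.integrable_sq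
  have i2 : Integrable (fun ω ↦ (f ω - (P[f | m]) ω) ^ 2) P := h2.integrable_sq
  have i3 : Integrable (fun ω ↦ 2 * ((h ω - (P[f | m]) ω) * (f ω - (P[f | m]) ω))) P :=
    (h1.integrable_mul h2).const_mul 2
  have : ∀ ω, (h ω - f ω) ^ 2 = (h ω - (P[f | m]) ω) ^ 2 + (f ω - (P[f | m]) ω) ^ 2 -
      2 * ((h ω - (P[f | m]) ω) * (f ω - (P[f | m]) ω)) := fun ω ↦ by ring
  simp_rw [this]
  rw [integral_sub (f := fun ω ↦ (h ω - (P[f | m]) ω) ^ 2 + (f ω - (P[f | m]) ω) ^ 2)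
    (i1.add i2) i3, integral_add i1 i2, integral_const_mul, h0]
  ring

/-- A process with right-continuous paths is jointly measurable: it is the pointwise limit of its
values at the next point of the grid of mesh
`1 / (n + 1)`, and these are measurable because the grid is countable. -/
theorem measurable_uncurry_of_rightContinuous {Ω : Type*} [MeasurableSpace Ω]
    {A : ℝ≥0 → Ω → ℝ} (hm : ∀ t, Measurable (A t))
    (hA : ∀ ω t, ContinuousWithinAt (fun s ↦ A s ω) (Ici t) t) :
    Measurable (fun q : ℝ≥0 × Ω ↦ A q.1 q.2) := by
  let g : ℕ → ℝ≥0 → ℝ≥0 := fun n t ↦ ((⌊(n + 1 : ℝ≥0) * t⌋₊ + 1 : ℕ) : ℝ≥0) / (n + 1)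
  have hg : ∀ n, Measurable fun q : ℝ≥0 × Ω ↦ A (g n q.1) q.2 := by
    intro n
    have h1 : Measurable fun q : ℕ × Ω ↦ A (((q.1 + 1 : ℕ) : ℝ≥0) / (n + 1)) q.2 :=
      measurable_from_prod_countable_right fun k ↦ hm (((k + 1 : ℕ) : ℝ≥0) / (n + 1))
    have h2 : Measurable fun q : ℝ≥0 × Ω ↦ (⌊(n + 1 : ℝ≥0) * q.1⌋₊, q.2) := by fun_prop
    exact h1.comp h2
  refine measurable_of_tendsto_metrizable hg ?_
  rw [tendsto_pi_nhds]
  rintro ⟨t, ω⟩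
  have hlim : Filter.Tendsto (fun n ↦ g n t) Filter.atTop (nhdsWithin t (Ici t)) := by
    have hup : ∀ n : ℕ, t ≤ g n t := fun n ↦ by
      have := (Nat.lt_floor_add_one ((n + 1 : ℝ≥0) * t)).le
      simp only [g]
      rw [le_div_iff₀ (by positivity), mul_comm]
      exact_mod_cast this
    have hlo : ∀ n : ℕ, g n t ≤ t + 1 / ((n : ℝ≥0) + 1) := fun n ↦ by
      have := Nat.floor_le (zero_le (a := (n + 1 : ℝ≥0) * t))
      simp only [g]
      have e : (t + 1 / ((n : ℝ≥0) + 1)) * (n + 1) = (n + 1) * t + 1 := by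
        field_simp
      rw [div_le_iff₀ (by positivity), e]
      push_cast
      gcongr
    refine tendsto_nhdsWithin_iff.2 ⟨?_, Filter.Eventually.of_forall hup⟩
    refine tendsto_of_tendsto_of_tendsto_of_le_of_le tendsto_const_nhds ?_ hup hlo
    have := (tendsto_one_div_add_atTop_nhds_zero_nat (𝕜 := ℝ≥0)).const_add t
    simpa using this
  exact (hA ω t).tendsto.comp hlim

/-! ### Decreasing rearrangement for discounted time -/


/-- The probability measure `r e^{-rs} ds` on `[0, ∞)`, regarded as a measure on `ℝ`. -/
noncomputable def discount (r : ℝ) : Measure ℝ :=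
  (volume.restrict (Ici 0)).withDensity fun s ↦ ENNReal.ofReal (r * Real.exp (-r * s))

theorem setLIntegral_discount (r : ℝ) {t : ℝ} (ht : 0 ≤ t) {f : ℝ → ℝ≥0∞} (hf : Measurable f) :
    ∫⁻ s in Ici t, f s ∂(discount r) =
      ∫⁻ s in Ici t, ENNReal.ofReal (r * Real.exp (-r * s)) * f s := by
  have hm : Measurable fun s : ℝ ↦ ENNReal.ofReal (r * Real.exp (-r * s)) := by fun_prop
  rw [discount, setLIntegral_withDensity_eq_setLIntegral_mul _ hm hf measurableSet_Ici,
    Measure.restrict_restrict measurableSet_Ici, inter_eq_left.2 (Ici_subset_Ici.2 ht)]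
  rfl

theorem discount_Ici {r : ℝ} (hr : 0 < r) {t : ℝ} (ht : 0 ≤ t) :
    discount r (Ici t) = ENNReal.ofReal (Real.exp (-r * t)) := by
  have h := setLIntegral_discount r ht (f := fun _ ↦ 1) measurable_const
  simp only [lintegral_const, Measure.restrict_apply, MeasurableSet.univ, univ_inter, one_mul,
    mul_one] at h
  rw [h, ← ofReal_integral_eq_lintegral_ofReal, integral_Ici_eq_integral_Ioi, integral_const_mul,
    integral_exp_mul_Ioi (by linarith)]
  · congr 1
    field_simp
  · exact (integrableOn_Ici_iff_integrableOn_Ioi (by simp) |>.2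
      (integrableOn_exp_mul_Ioi (by linarith : -r < 0) t)).const_mul r
  · exact Filter.Eventually.of_forall fun s ↦ by positivity

theorem isProbabilityMeasure_discount {r : ℝ} (hr : 0 < r) : IsProbabilityMeasure (discount r) := by
  constructor
  have h : discount r (Iio 0) = 0 := by
    rw [discount, withDensity_apply _ measurableSet_Iio,
      Measure.restrict_restrict measurableSet_Iio, Iio_inter_Ici]
    simp
  rw [← Iio_union_Ici (a := (0 : ℝ)), measure_union (Iio_disjoint_Ici le_rfl) measurableSet_Ici, h,
    discount_Ici hr le_rfl]
  simp

theorem ae_discount_nonneg (r : ℝ) : ∀ᵐ s ∂(discount r), 0 ≤ s := by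
  exact (withDensity_absolutelyContinuous _ _).ae_le (ae_restrict_mem measurableSet_Ici)

/-- Under the distribution function `s ↦ 1 - e^{-rs}`, the measure `discount r` becomes uniform. -/
theorem discount_setOf_lt {r : ℝ} (hr : 0 < r) {t c : ℝ} (ht : 0 ≤ t) (hc : c ≤ 1) :
    discount r {s | t ≤ s ∧ 1 - Real.exp (-r * s) < c} =
      ENNReal.ofReal (c - (1 - Real.exp (-r * t))) := by
  rcases hc.eq_or_lt with rfl | hc
  · have : {s | t ≤ s ∧ 1 - Real.exp (-r * s) < 1} = Ici t := by
      ext s; simp [Real.exp_pos]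
    rw [this, discount_Ici hr ht]
    simp
  obtain ⟨q, hq⟩ : ∃ q, Real.exp (-r * q) = 1 - c := by
    refine ⟨-Real.log (1 - c) / r, ?_⟩
    rw [show -r * (-Real.log (1 - c) / r) = Real.log (1 - c) by field_simp,
      Real.exp_log (by linarith)]
  have hlt : ∀ s, 1 - Real.exp (-r * s) < c ↔ s < q := fun s ↦ by
    rw [sub_lt_comm, ← hq, Real.exp_lt_exp]
    constructor
    · intro h; nlinarith
    · intro h; nlinarith
  simp_rw [hlt]
  rcases le_total q t with hqt | hqt
  · have : {s | t ≤ s ∧ s < q} = ∅ := by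
      ext s; simp; intro h; linarith
    have h2 : Real.exp (-r * t) ≤ Real.exp (-r * q) := Real.exp_le_exp.2 (by nlinarith)
    rw [this, measure_empty, ENNReal.ofReal_of_nonpos (by linarith)]
  · have := isProbabilityMeasure_discount hr
    have e : {s | t ≤ s ∧ s < q} = Ici t \ Ici q := by ext s; simp
    rw [e, measure_sdiff (Ici_subset_Ici.2 hqt) measurableSet_Ici.nullMeasurableSet (by simp),
      discount_Ici hr ht, discount_Ici hr (ht.trans hqt), ← ENNReal.ofReal_sub _ (by positivity),
      hq]
    congr 1; ring

/-- The decreasing rearrangement of a bounded function `g ≥ 0` with respect to `discount r`. It is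
right-continuous, has the same law as `g`, and each of its tails carries the least second moment
among all equimeasurable functions, so at most that of `g`. -/
theorem exists_decreasing_rearrangement {r : ℝ} (hr : 0 < r) {β : ℝ} (hβ : 0 ≤ β) {g : ℝ → ℝ}
    (hg : Measurable g) (g0 : ∀ s, 0 ≤ g s) (gβ : ∀ s, g s ≤ β) :
    ∃ b : ℝ → ℝ, Measurable b ∧ (∀ s, 0 ≤ b s) ∧ (∀ s, b s ≤ β) ∧
      (∀ t, 0 ≤ t → ContinuousWithinAt b (Ici t) t) ∧
      (discount r).map b = (discount r).map g ∧
      ∀ t, 0 ≤ t → ∫⁻ s in Ici t, ENNReal.ofReal (b s ^ 2) ∂(discount r) ≤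
        ∫⁻ s in Ici t, ENNReal.ofReal (g s ^ 2) ∂(discount r) := by
  have hP := isProbabilityMeasure_discount hr
  set μ := discount r
  let F : ℝ → ℝ := fun y ↦ μ.real {s | y < g s}
  let m : ℝ → ℝ := fun s ↦ 1 - Real.exp (-r * max s 0)
  have m_mono : Monotone m := fun s t h ↦ by
    have : max s 0 ≤ max t 0 := max_le_max h le_rfl
    have := Real.exp_le_exp.2 (show -r * max t 0 ≤ -r * max s 0 by nlinarith)
    simp only [m]; linarith
  have m_cont : Continuous m := by fun_prop
  have m0 : ∀ s, 0 ≤ m s := fun s ↦ by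
    have : Real.exp (-r * max s 0) ≤ 1 := Real.exp_le_one_iff.2 (by nlinarith [le_max_right s 0])
    simp only [m]; linarith
  have F_anti : Antitone F := fun y z h ↦ measureReal_mono fun s hs ↦ lt_of_le_of_lt h hs
  have F1 : ∀ y, F y ≤ 1 := fun y ↦ measureReal_le_one
  have Fβ : F β = 0 := by
    have : {s | β < g s} = ∅ := by ext s; simpa using gβ s
    simp [F, this]
  -- Right-continuity of the survival function, in the form used for the quantile function.
  have F_rc : ∀ y c, (∀ z, y < z → F z ≤ c) → F y ≤ c := by
    intro y c h
    have hU : {s | y < g s} = ⋃ n : ℕ, {s | y + 1 / ((n : ℝ) + 1) < g s} := by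
      ext s
      simp only [mem_ofPred_eq, mem_iUnion]
      constructor
      · intro hs
        obtain ⟨n, hn⟩ := exists_nat_one_div_lt (sub_pos.2 hs)
        exact ⟨n, by linarith⟩
      · rintro ⟨n, hn⟩
        have : 0 < 1 / ((n : ℝ) + 1) := by positivity
        linarith
    have hlim := tendsto_measure_iUnion_atTop (μ := μ)
      (s := fun n : ℕ ↦ {s | y + 1 / ((n : ℝ) + 1) < g s}) (fun n k hnk s hs ↦ by
        have : 1 / ((k : ℝ) + 1) ≤ 1 / ((n : ℝ) + 1) :=
          one_div_le_one_div_of_le (by positivity) (by exact_mod_cast Nat.succ_le_succ hnk)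
        simp only [mem_ofPred_eq] at hs ⊢
        linarith)
    rw [← hU] at hlim
    have hlim' := (ENNReal.tendsto_toReal (measure_ne_top _ _)).comp hlim
    exact le_of_tendsto' hlim' fun n ↦ h _ (by
      have : 0 < 1 / ((n : ℝ) + 1) := by positivity
      linarith)
  -- The quantile function of `g`; `galois` says that it is the generalized inverse of `F`.
  let b : ℝ → ℝ := fun s ↦ sInf {y | 0 ≤ y ∧ F y ≤ m s}
  have hbdd : ∀ s, BddBelow {y | 0 ≤ y ∧ F y ≤ m s} := fun s ↦ ⟨0, fun y hy ↦ hy.1⟩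
  have hne : ∀ s, β ∈ {y | 0 ≤ y ∧ F y ≤ m s} := fun s ↦ ⟨hβ, by rw [Fβ]; exact m0 s⟩
  have b0 : ∀ s, 0 ≤ b s := fun s ↦ le_csInf ⟨β, hne s⟩ fun y hy ↦ hy.1
  have bβ : ∀ s, b s ≤ β := fun s ↦ csInf_le (hbdd s) (hne s)
  have galois : ∀ s y, 0 ≤ y → (b s ≤ y ↔ F y ≤ m s) := by
    intro s y hy
    constructor
    · intro h
      refine F_rc y _ fun z hz ↦ ?_
      obtain ⟨w, hw, hwz⟩ := exists_lt_of_csInf_lt ⟨β, hne s⟩ (lt_of_le_of_lt h hz)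
      exact (F_anti hwz.le).trans hw.2
    · intro h
      exact csInf_le (hbdd s) ⟨hy, h⟩
  have galois' : ∀ s y, 0 ≤ y → (y < b s ↔ m s < F y) := fun s y hy ↦ by
    rw [← not_le, galois s y hy, not_le]
  have b_anti : Antitone b := fun s t h ↦
    (galois t _ (b0 s)).2 (((galois s _ (b0 s)).1 le_rfl).trans (m_mono h))
  have b_meas : Measurable b := b_anti.measurable
  -- `b > y` holds on an initial interval of measure `F y`, so a tail of `discount r` meets
  -- `{b > y}` in the least measure possible for a set of measure `F y`.
  have tail : ∀ t y, 0 ≤ t → 0 ≤ y →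
      μ (Ici t ∩ {s | y < b s}) = ENNReal.ofReal (F y - (1 - Real.exp (-r * t))) := by
    intro t y ht hy
    rw [← discount_setOf_lt hr ht (F1 y)]
    congr 1
    ext s
    simp only [mem_inter_iff, mem_Ici, mem_ofPred_eq, galois' s y hy]
    refine and_congr_right fun hs ↦ ?_
    simp only [m, max_eq_left (ht.trans hs)]
  have tail_le : ∀ t y, 0 ≤ t → 0 ≤ y →
      μ (Ici t ∩ {s | y < b s}) ≤ μ (Ici t ∩ {s | y < g s}) := by
    intro t y ht hy
    rw [tail t y ht hy, ← ofReal_measureReal (μ := μ) (s := Ici t ∩ {s | y < g s})]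
    apply ENNReal.ofReal_le_ofReal
    have h1 : F y ≤ μ.real (Ici t ∩ {s | y < g s}) + μ.real (Ici t)ᶜ := by
      refine (measureReal_mono ?_).trans (measureReal_union_le _ _)
      intro s hs
      by_cases h : t ≤ s
      · exact Or.inl ⟨h, hs⟩
      · exact Or.inr h
    have h2 : μ.real (Ici t)ᶜ = 1 - Real.exp (-r * t) := by
      rw [measureReal_compl measurableSet_Ici, probReal_univ, measureReal_def, discount_Ici hr ht,
        ENNReal.toReal_ofReal (Real.exp_pos _).le]
    linarith
  have meas_eq : ∀ y, 0 ≤ y → μ {s | y < b s} = μ {s | y < g s} := by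
    intro y hy
    have h := tail 0 y le_rfl hy
    have e : μ (Ici 0 ∩ {s | y < b s}) = μ {s | y < b s} := by
      apply measure_congr
      filter_upwards [ae_discount_nonneg r] with s hs
      simp only [eq_iff_iff]
      exact ⟨fun h ↦ h.2, fun h ↦ ⟨hs, h⟩⟩
    rw [← e, h]
    simp [F]
  refine ⟨b, b_meas, b0, bβ, ?_, ?_, ?_⟩
  · intro t ht
    refine tendsto_order.2 ⟨fun c hc ↦ ?_, fun c hc ↦ ?_⟩
    · rcases lt_or_ge c 0 with h0 | h0
      · exact Filter.Eventually.of_forall fun s ↦ h0.trans_le (b0 s)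
      · have := (m_cont.tendsto t).eventually_lt_const ((galois' t c h0).1 hc)
        filter_upwards [nhdsWithin_le_nhds this] with s hs
        exact (galois' s c h0).2 hs
    · filter_upwards [self_mem_nhdsWithin] with s hs
      exact (b_anti hs).trans_lt hc
  · have i1 := Measure.isProbabilityMeasure_map (μ := μ) b_meas.aemeasurable
    have i2 := Measure.isProbabilityMeasure_map (μ := μ) hg.aemeasurable
    have hIoi : ∀ y, μ (b ⁻¹' Ioi y) = μ (g ⁻¹' Ioi y) := fun y ↦ by
      rcases lt_or_ge y 0 with h0 | h0
      · have e1 : b ⁻¹' Ioi y = univ := by ext s; simpa using h0.trans_le (b0 s)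
        have e2 : g ⁻¹' Ioi y = univ := by ext s; simpa using h0.trans_le (g0 s)
        rw [e1, e2]
      · exact meas_eq y h0
    refine Measure.ext_of_Iic _ _ fun y ↦ ?_
    rw [Measure.map_apply b_meas measurableSet_Iic, Measure.map_apply hg measurableSet_Iic,
      ← compl_Ioi, preimage_compl, preimage_compl, prob_compl_eq_one_sub (b_meas measurableSet_Ioi),
      prob_compl_eq_one_sub (hg measurableSet_Ioi), hIoi]
  · intro t ht
    have lc : ∀ f : ℝ → ℝ, Measurable f → (∀ s, 0 ≤ f s) →
        ∫⁻ s in Ici t, ENNReal.ofReal (f s ^ 2) ∂μ =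
          ∫⁻ y in Ioi (0 : ℝ), μ (Ici t ∩ {s | y < f s}) * ENNReal.ofReal (2 * y) := by
      intro f hf f0
      have h := lintegral_comp_eq_lintegral_meas_lt_mul (μ.restrict (Ici t)) (f := f)
        (g := fun y ↦ 2 * y) (Filter.Eventually.of_forall f0) hf.aemeasurable
        (fun _ _ ↦ (by fun_prop : Continuous fun y : ℝ ↦ 2 * y).intervalIntegrable _ _)
        ((ae_restrict_mem measurableSet_Ioi).mono fun y hy ↦ by
          have : (0 : ℝ) < y := hy
          positivity)
      have e : ∀ x : ℝ, ∫ y in (0 : ℝ)..x, 2 * y = x ^ 2 := fun x ↦ by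
        rw [intervalIntegral.integral_const_mul, integral_id]; ring
      simp only [e] at h
      rw [h]
      refine lintegral_congr fun y ↦ ?_
      rw [Measure.restrict_apply (measurableSet_lt measurable_const hf), inter_comm]
    rw [lc b b_meas b0, lc g hg g0]
    refine setLIntegral_mono' measurableSet_Ioi fun y hy ↦ ?_
    exact mul_le_mul_left (tail_le t y ht (le_of_lt hy)) _

/-! ### The state equation along paths -/


/-- The noise `(θ_t - θ_0 - κ ∫_0^t θ_u du) / σ` that a continuous path `θ` feeds into
`dθ = κ θ dt + σ dZ`. It is continuous on every path, so it replaces the driving Brownian motion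
`Z`, with which it agrees almost surely, wherever an exceptional null set would be in the way. -/
noncomputable def drivingPath (κ σ : ℝ) (θ : ℝ≥0 → ℝ) (t : ℝ) : ℝ :=
  (θ t.toNNReal - θ 0 - κ * ∫ u in (0 : ℝ)..t, θ u.toNNReal) / σ

theorem continuous_drivingPath (κ σ : ℝ) {θ : ℝ≥0 → ℝ} (hθ : Continuous θ) :
    Continuous (drivingPath κ σ θ) := by
  have h : Continuous fun u : ℝ ↦ θ u.toNNReal := hθ.comp continuous_real_toNNReal
  have h2 : Continuous fun t : ℝ ↦ ∫ u in (0 : ℝ)..t, θ u.toNNReal :=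
    intervalIntegral.continuous_primitive (fun _ _ ↦ h.intervalIntegrable _ _) 0
  unfold drivingPath
  fun_prop

theorem drivingPath_zero (κ σ : ℝ) (θ : ℝ≥0 → ℝ) : drivingPath κ σ θ 0 = 0 := by
  simp [drivingPath]

/-- Variation of constants for the increments of `e^{-κt} θ_t`, after an integration by parts that
removes the stochastic integral. -/
theorem exp_mul_sub_exp_mul (κ : ℝ) {σ : ℝ} (hσ : σ ≠ 0) {θ : ℝ≥0 → ℝ} (hθ : Continuous θ)
    (s t : ℝ) :
    Real.exp (-κ * t) * θ t.toNNReal - Real.exp (-κ * s) * θ s.toNNReal =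
      σ * (Real.exp (-κ * t) * (drivingPath κ σ θ t - drivingPath κ σ θ s) +
        κ * ∫ u in s..t, Real.exp (-κ * u) * (drivingPath κ σ θ u - drivingPath κ σ θ s)) := by
  have hc : Continuous fun u : ℝ ↦ θ u.toNNReal := hθ.comp continuous_real_toNNReal
  set z := drivingPath κ σ θ with hz
  have zc : Continuous z := continuous_drivingPath κ σ hθ
  let I : ℝ → ℝ := fun t ↦ ∫ u in (0 : ℝ)..t, θ u.toNNReal
  have hI : ∀ t, HasDerivAt I (θ t.toNNReal) t := fun t ↦
    hc.integral_hasStrictDerivAt 0 t |>.hasDerivAt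
  have zeq : ∀ t, θ t.toNNReal = θ 0 + κ * I t + σ * z t := fun t ↦ by
    simp only [hz, drivingPath, I]
    field_simp
    ring
  have hexp : ∀ t, HasDerivAt (fun t ↦ Real.exp (-κ * t)) (Real.exp (-κ * t) * -κ) t := fun t ↦ by
    simpa using ((hasDerivAt_id t).const_mul (-κ)).exp
  have hF : ∀ t, HasDerivAt (fun t ↦ Real.exp (-κ * t) * (θ 0 + κ * I t))
      (κ * σ * (Real.exp (-κ * t) * z t)) t := fun t ↦ by
    have := (hexp t).mul (((hI t).const_mul κ).const_add (θ 0))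
    refine this.congr_deriv ?_
    rw [zeq t]; ring
  have ec : Continuous fun u ↦ Real.exp (-κ * u) * z u := by fun_prop
  have ftc := intervalIntegral.integral_eq_sub_of_hasDerivAt (a := s) (b := t)
    (fun u _ ↦ hF u) ((ec.const_mul (κ * σ)).intervalIntegrable _ _)
  have ftc2 := intervalIntegral.integral_eq_sub_of_hasDerivAt (a := s) (b := t)
    (fun u _ ↦ hexp u)
    ((by fun_prop : Continuous fun u ↦ Real.exp (-κ * u) * -κ).intervalIntegrable _ _)
  rw [intervalIntegral.integral_const_mul] at ftc
  rw [intervalIntegral.integral_mul_const] at ftc2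
  have split : ∫ u in s..t, Real.exp (-κ * u) * (z u - z s) =
      (∫ u in s..t, Real.exp (-κ * u) * z u) - (∫ u in s..t, Real.exp (-κ * u)) * z s := by
    rw [← intervalIntegral.integral_mul_const, ← intervalIntegral.integral_sub
      (ec.intervalIntegrable _ _)
      ((by fun_prop : Continuous fun u ↦ Real.exp (-κ * u) * z s).intervalIntegrable _ _)]
    congr 1; ext u; ring
  rw [split, zeq t, zeq s]
  linear_combination -ftc - σ * z s * ftc2

theorem measurable_intervalIntegral_of_continuous {Ω : Type*} {m : MeasurableSpace Ω}
    {f : ℝ → Ω → ℝ} (hc : ∀ ω, Continuous fun u ↦ f u ω) (hm : ∀ u, Measurable (f u)) (a b : ℝ) :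
    Measurable fun ω ↦ ∫ u in a..b, f u ω := by
  have h1 : Measurable (Function.uncurry f) := measurable_uncurry_of_continuous_of_measurable hc hm
  have h2 : StronglyMeasurable (fun q : Ω × ℝ ↦ f q.2 q.1) :=
    (h1.comp measurable_swap).stronglyMeasurable
  simp only [intervalIntegral]
  exact (h2.integral_prod_right'.sub h2.integral_prod_right').measurable

theorem memLp_two_intervalIntegral {Ω : Type*} [MeasurableSpace Ω] {P : Measure Ω}
    [IsProbabilityMeasure P] {f : ℝ → Ω → ℝ} (hc : ∀ ω, Continuous fun u ↦ f u ω)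
    (hm : ∀ u, Measurable (f u)) {a b : ℝ} (hab : a ≤ b) {C : ℝ≥0∞} (hC : C ≠ ∞)
    (hf : ∀ u ∈ Icc a b, ∫⁻ ω, ‖f u ω‖ₑ ^ (2 : ℝ) ∂P ≤ C) :
    MemLp (fun ω ↦ ∫ u in a..b, f u ω) 2 P := by
  have h1 : Measurable (Function.uncurry f) := measurable_uncurry_of_continuous_of_measurable hc hm
  refine ⟨(measurable_intervalIntegral_of_continuous hc hm a b).aestronglyMeasurable, ?_⟩
  rw [eLpNorm_lt_top_iff_lintegral_rpow_enorm_lt_top (by norm_num) (by norm_num)]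
  have key : ∀ ω, ‖∫ u in a..b, f u ω‖ₑ ^ (2 : ℝ) ≤
      volume (Ioc a b) * ∫⁻ u in Ioc a b, ‖f u ω‖ₑ ^ (2 : ℝ) := by
    intro ω
    rw [intervalIntegral.integral_of_le hab]
    have hold := ENNReal.lintegral_mul_le_Lp_mul_Lq (volume.restrict (Ioc a b))
      (Real.HolderConjugate.two_two) (f := fun u ↦ ‖f u ω‖ₑ) (g := fun _ ↦ 1)
      (by have := (hc ω).measurable; fun_prop) (by fun_prop)
    simp only [Pi.mul_apply, mul_one, ENNReal.one_rpow, lintegral_const,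
      Measure.restrict_apply, MeasurableSet.univ, univ_inter, one_mul] at hold
    calc ‖∫ u in Ioc a b, f u ω‖ₑ ^ (2 : ℝ)
        ≤ (∫⁻ u in Ioc a b, ‖f u ω‖ₑ) ^ (2 : ℝ) := by
          gcongr; exact enorm_integral_le_lintegral_enorm _
      _ ≤ ((∫⁻ u in Ioc a b, ‖f u ω‖ₑ ^ (2 : ℝ)) ^ (1 / 2 : ℝ) *
            volume (Ioc a b) ^ (1 / 2 : ℝ)) ^ (2 : ℝ) := by gcongr
      _ = _ := by
          rw [ENNReal.mul_rpow_of_nonneg _ _ (by norm_num), ← ENNReal.rpow_mul,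
            ← ENNReal.rpow_mul]
          norm_num
          rw [mul_comm]
  calc ∫⁻ ω, ‖∫ u in a..b, f u ω‖ₑ ^ (2 : ℝ≥0∞).toReal ∂P
      ≤ ∫⁻ ω, (volume (Ioc a b) * ∫⁻ u in Ioc a b, ‖f u ω‖ₑ ^ (2 : ℝ)) ∂P := by
        refine lintegral_mono fun ω ↦ ?_
        simpa using key ω
    _ = volume (Ioc a b) * ∫⁻ u in Ioc a b, ∫⁻ ω, ‖f u ω‖ₑ ^ (2 : ℝ) ∂P := by
        have hmeas : Measurable (Function.uncurry fun (ω : Ω) (u : ℝ) ↦ ‖f u ω‖ₑ ^ (2 : ℝ)) :=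
          ((h1.comp measurable_swap).enorm).pow_const 2
        rw [lintegral_const_mul' _ _ (by simp), lintegral_lintegral_swap hmeas.aemeasurable]
    _ ≤ volume (Ioc a b) * ∫⁻ u in Ioc a b, C := by
        refine mul_le_mul' le_rfl ?_
        exact setLIntegral_mono' measurableSet_Ioc fun u hu ↦ hf u ⟨hu.1.le, hu.2⟩
    _ < ∞ := by
        simp only [lintegral_const, Measure.restrict_apply, MeasurableSet.univ, univ_inter,
          Real.volume_Ioc]
        exact ENNReal.mul_lt_top (by simp) (ENNReal.mul_lt_top hC.lt_top (by simp))

theorem integral_intervalIntegral_eq_zero {Ω : Type*} [MeasurableSpace Ω] {P : Measure Ω}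
    [IsProbabilityMeasure P] {f : ℝ → Ω → ℝ} (hc : ∀ ω, Continuous fun u ↦ f u ω)
    (hm : ∀ u, Measurable (f u)) {a b : ℝ} (hab : a ≤ b) {C : ℝ≥0∞} (hC : C ≠ ∞)
    (hf : ∀ u ∈ Icc a b, ∫⁻ ω, ‖f u ω‖ₑ ^ (2 : ℝ) ∂P ≤ C)
    (h0 : ∀ u ∈ Icc a b, ∫ ω, f u ω ∂P = 0) :
    ∫ ω, (∫ u in a..b, f u ω) ∂P = 0 := by
  have h1 : Measurable (Function.uncurry f) := measurable_uncurry_of_continuous_of_measurable hc hm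
  have hmeas : Measurable (Function.uncurry fun (ω : Ω) (u : ℝ) ↦ f u ω) := h1.comp measurable_swap
  simp_rw [intervalIntegral.integral_of_le hab]
  rw [integral_integral_swap]
  · rw [setIntegral_congr_fun measurableSet_Ioc (fun u hu ↦ h0 u ⟨hu.1.le, hu.2⟩)]
    simp
  · refine ⟨hmeas.aestronglyMeasurable, ?_⟩
    have le1 : ∀ x : ℝ≥0∞, x ≤ 1 + x ^ (2 : ℝ) := fun x ↦ by
      rcases le_total x 1 with h | h
      · exact h.trans le_self_add
      · calc x = x ^ (1 : ℝ) := (ENNReal.rpow_one x).symm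
          _ ≤ x ^ (2 : ℝ) := ENNReal.rpow_le_rpow_of_exponent_le h (by norm_num)
          _ ≤ _ := le_add_self
    calc ∫⁻ q, ‖Function.uncurry (fun ω u ↦ f u ω) q‖ₑ ∂(P.prod (volume.restrict (Ioc a b)))
        = ∫⁻ u in Ioc a b, ∫⁻ ω, ‖f u ω‖ₑ ∂P := by
          rw [lintegral_prod_symm' _ hmeas.enorm]; rfl
      _ ≤ ∫⁻ u in Ioc a b, (1 + C) := by
          refine setLIntegral_mono' measurableSet_Ioc fun u hu ↦ ?_
          calc ∫⁻ ω, ‖f u ω‖ₑ ∂P ≤ ∫⁻ ω, (1 + ‖f u ω‖ₑ ^ (2 : ℝ)) ∂P :=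
                lintegral_mono fun ω ↦ le1 _
            _ ≤ 1 + C := by
                rw [lintegral_add_left measurable_const]
                simp only [lintegral_const, measure_univ, mul_one]
                gcongr
                exact hf u ⟨hu.1.le, hu.2⟩
      _ < ∞ := by
          simp only [lintegral_const, Measure.restrict_apply, MeasurableSet.univ, univ_inter,
            Real.volume_Ioc]
          exact ENNReal.mul_lt_top (ENNReal.add_lt_top.2 ⟨by simp, hC.lt_top⟩) (by simp)

/-! ### Increments of the discounted state -/


theorem measurable_comap_apply {Ω α ι : Type*} [MeasurableSpace α] (X : ι → Ω → α) (i : ι) :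
    Measurable[MeasurableSpace.comap (fun ω j ↦ X j ω) inferInstance] (X i) :=
  (measurable_pi_apply i).comp (comap_measurable fun ω j ↦ X j ω)

/-- An increment of the discounted state over `[s, t]` is a function of the increments of the noise
over `[s, t]`. -/
theorem measurable_exp_mul_sub {Ω : Type*} {m : MeasurableSpace Ω} {θ : ℝ≥0 → Ω → ℝ} {κ σ : ℝ}
    (hσ : σ ≠ 0) (hc : ∀ ω, Continuous fun t ↦ θ t ω) {s t : ℝ} (hst : s ≤ t)
    (h : ∀ u ∈ Icc s t, Measurable fun ω ↦
      drivingPath κ σ (fun t ↦ θ t ω) u - drivingPath κ σ (fun t ↦ θ t ω) s) :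
    Measurable fun ω ↦ Real.exp (-κ * t) * θ t.toNNReal ω - Real.exp (-κ * s) * θ s.toNNReal ω := by
  simp_rw [fun ω ↦ exp_mul_sub_exp_mul κ hσ (hc ω) s t]
  -- Clipping the time keeps the integrand measurable outside `[s, t]` as well.
  have clip : ∀ ω, ∫ u in s..t, Real.exp (-κ * u) *
        (drivingPath κ σ (fun t ↦ θ t ω) u - drivingPath κ σ (fun t ↦ θ t ω) s) =
      ∫ u in s..t, Real.exp (-κ * u) *
        (drivingPath κ σ (fun t ↦ θ t ω) (max s (min u t)) -
          drivingPath κ σ (fun t ↦ θ t ω) s) := fun ω ↦ by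
    refine intervalIntegral.integral_congr fun u hu ↦ ?_
    rw [uIcc_of_le hst] at hu
    rw [min_eq_left hu.2, max_eq_right hu.1]
  simp_rw [clip]
  have h1 := measurable_intervalIntegral_of_continuous (f := fun u ω ↦ Real.exp (-κ * u) *
        (drivingPath κ σ (fun t ↦ θ t ω) (max s (min u t)) -
          drivingPath κ σ (fun t ↦ θ t ω) s))
    (fun ω ↦ by
      have := continuous_drivingPath κ σ (hc ω)
      fun_prop)
    (fun u ↦ (h _ ⟨le_max_left _ _, max_le hst (min_le_right _ _)⟩).const_mul _) s t
  have h2 := h t ⟨hst, le_rfl⟩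
  exact ((h2.const_mul _).add (h1.const_mul _)).const_mul _

theorem IsEnvironment.measurable_drivingPath {Ω : Type*} [MeasurableSpace Ω] {P : Measure Ω}
    {κ σ μ₀ : ℝ} {σ₀ : ℝ≥0} {Z Y θ : ℝ≥0 → Ω → ℝ}
    (hE : IsEnvironment P κ σ μ₀ σ₀ Z Y θ) (u : ℝ) :
    Measurable fun ω ↦ drivingPath κ σ (fun t ↦ θ t ω) u := by
  have h1 : Measurable fun ω ↦ ∫ v in (0 : ℝ)..u, θ v.toNNReal ω :=
    measurable_intervalIntegral_of_continuous
      (fun ω ↦ (hE.continuous_θ ω).comp continuous_real_toNNReal) (fun v ↦ hE.measurable_θ _) 0 u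
  have h2 := hE.measurable_θ u.toNNReal
  have h3 := hE.measurable_θ 0
  unfold drivingPath
  fun_prop

theorem IsEnvironment.ae_drivingPath_eq {Ω : Type*} [MeasurableSpace Ω] {P : Measure Ω}
    {κ σ μ₀ : ℝ} {σ₀ : ℝ≥0} {Z Y θ : ℝ≥0 → Ω → ℝ}
    (hE : IsEnvironment P κ σ μ₀ σ₀ Z Y θ) (hσ : σ ≠ 0) :
    ∀ᵐ ω ∂P, ∀ t : ℝ≥0, drivingPath κ σ (fun t ↦ θ t ω) t = Z t ω := by
  filter_upwards [hE.sde] with ω h t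
  rw [drivingPath, Real.toNNReal_coe, h t]
  field_simp
  ring

theorem history_mono {Ω : Type*} (X : ℝ≥0 → Ω → ℝ) {s t : ℝ≥0} (h : s ≤ t) :
    history X s ≤ history X t :=
  iSup₂_le fun u hu ↦ le_iSup₂_of_le (f := fun v (_ : v ≤ t) ↦
    MeasurableSpace.comap (X v) inferInstance) u (hu.trans h) le_rfl

theorem measurable_history {Ω : Type*} (X : ℝ≥0 → Ω → ℝ) {s t : ℝ≥0} (h : s ≤ t) :
    Measurable[history X t] (X s) :=
  Measurable.mono (comap_measurable (X s)) (le_iSup₂_of_le (f := fun v (_ : v ≤ t) ↦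
    MeasurableSpace.comap (X v) inferInstance) s h le_rfl) le_rfl

theorem history_le {Ω : Type*} {m : MeasurableSpace Ω} {X : ℝ≥0 → Ω → ℝ} {t : ℝ≥0}
    (h : ∀ s ≤ t, Measurable (X s)) : history X t ≤ m :=
  iSup₂_le fun s hs ↦ (h s hs).comap_le

theorem senderInfo_mono {Ω : Type*} (Y θ : ℝ≥0 → Ω → ℝ) {s t : ℝ≥0} (h : s ≤ t) :
    senderInfo Y θ s ≤ senderInfo Y θ t :=
  sup_le_sup le_rfl (history_mono θ h)

theorem measurable_senderInfo_state {Ω : Type*} (Y θ : ℝ≥0 → Ω → ℝ) {s t : ℝ≥0} (h : s ≤ t) :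
    Measurable[senderInfo Y θ t] (θ s) :=
  (measurable_history θ h).mono le_sup_right le_rfl

theorem measurable_senderInfo_device {Ω : Type*} (Y θ : ℝ≥0 → Ω → ℝ) (u t : ℝ≥0) :
    Measurable[senderInfo Y θ t] (Y u) :=
  Measurable.mono (comap_measurable (Y u))
    ((le_iSup (fun u ↦ MeasurableSpace.comap (Y u) inferInstance) u).trans le_sup_left) le_rfl

theorem IsEnvironment.senderInfo_le {Ω : Type*} [mΩ : MeasurableSpace Ω] {P : Measure Ω}
    {κ σ μ₀ : ℝ} {σ₀ : ℝ≥0} {Z Y θ : ℝ≥0 → Ω → ℝ}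
    (hE : IsEnvironment P κ σ μ₀ σ₀ Z Y θ) (t : ℝ≥0) : senderInfo Y θ t ≤ mΩ :=
  sup_le (iSup_le fun u ↦ (hE.measurable_Y u).comap_le)
    (history_le fun s _ ↦ hE.measurable_θ s)

/-- The discounted state `e^{-κt} θ_t` has increments that are independent of everything the sender
knows at the start of the increment. -/
theorem IsEnvironment.indep_increment {Ω : Type*} [mΩ : MeasurableSpace Ω] {P : Measure Ω}
    [IsProbabilityMeasure P] {κ σ μ₀ : ℝ} {σ₀ : ℝ≥0} {Z Y θ : ℝ≥0 → Ω → ℝ}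
    (hE : IsEnvironment P κ σ μ₀ σ₀ Z Y θ) (hσ : σ ≠ 0) {s t : ℝ≥0} (hst : s ≤ t) :
    Indep (senderInfo Y θ s) (MeasurableSpace.comap
      (fun ω ↦ Real.exp (-κ * t) * θ t ω - Real.exp (-κ * s) * θ s ω) inferInstance) P := by
  -- `W` is indistinguishable from `Z` and makes the identities below hold on all of `Ω`.
  let W : ℝ≥0 → Ω → ℝ := fun t ω ↦ drivingPath κ σ (fun t ↦ θ t ω) t
  have hW : ∀ t, Measurable (W t) := fun t ↦ hE.measurable_drivingPath t
  have hWZ : ∀ᵐ ω ∂P, ∀ t, Z t ω = W t ω := by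
    filter_upwards [hE.ae_drivingPath_eq hσ] with ω h t using (h t).symm
  let inc : Ω → ℝ≥0 → ℝ := fun ω u ↦ W (s + u) ω - W s ω
  let past : Ω → Set.Iic s → ℝ := fun ω u ↦ W u ω
  have hinc : IndepFun inc past P := by
    refine (hE.brownian_Z.indepFun_shift s).congr ?_ ?_
    · filter_upwards [hWZ] with ω h
      simp [h, inc]
    · filter_upwards [hWZ] with ω h
      simp [h, past]
  have h0 : IndepFun (θ 0) (fun ω t ↦ W t ω) P := by
    refine hE.indep_θ_zero_Z.congr (Filter.EventuallyEq.rfl) ?_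
    filter_upwards [hWZ] with ω h
    simp [h]
  rw [IndepFun_iff_Indep] at hinc h0
  have hmI : (MeasurableSpace.pi.comap inc) ≤ mΩ := (measurable_pi_lambda _ fun u ↦ (hW _).sub (hW _)).comap_le
  have hmP : (MeasurableSpace.pi.comap past) ≤ mΩ := (measurable_pi_lambda _ fun u ↦ hW _).comap_le
  have hm₀ : (MeasurableSpace.comap (θ 0) inferInstance) ≤ mΩ := (hE.measurable_θ 0).comap_le
  have hW' : ∀ u, Measurable[MeasurableSpace.comap (fun ω t ↦ W t ω) inferInstance] (W u) :=
    fun u ↦ measurable_comap_apply W u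
  have hle : (MeasurableSpace.pi.comap past) ⊔ (MeasurableSpace.pi.comap inc) ≤ MeasurableSpace.comap (fun ω t ↦ W t ω) inferInstance := by
    refine sup_le ?_ ?_
    · refine Measurable.comap_le ?_
      exact @measurable_pi_lambda _ _ _ (_) _ _ fun u ↦ hW' _
    · refine Measurable.comap_le ?_
      exact @measurable_pi_lambda _ _ _ (_) _ _ fun u ↦ Measurable.sub (hW' _) (hW' _)
  have key1 : Indep ((MeasurableSpace.comap (θ 0) inferInstance) ⊔ (MeasurableSpace.pi.comap past)) (MeasurableSpace.pi.comap inc) P :=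
    indep_sup_left_of_indep hm₀ hmP hmI (indep_of_indep_of_le_right h0 hle) hinc.symm
  have hhist : history θ s ≤ (MeasurableSpace.comap (θ 0) inferInstance) ⊔ (MeasurableSpace.pi.comap past) := by
    refine history_le fun u hu ↦ ?_
    have h1 : Measurable[(MeasurableSpace.comap (θ 0) inferInstance) ⊔ (MeasurableSpace.pi.comap past)] fun ω ↦
        Real.exp (-κ * (u : ℝ)) * θ (u : ℝ).toNNReal ω -
          Real.exp (-κ * (0 : ℝ)) * θ (0 : ℝ).toNNReal ω := by
      refine measurable_exp_mul_sub (m := (MeasurableSpace.comap (θ 0) inferInstance) ⊔ (MeasurableSpace.pi.comap past)) hσ hE.continuous_θ u.2 fun v hv ↦ ?_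
      simp only [drivingPath_zero, sub_zero]
      have : Measurable[MeasurableSpace.pi.comap past] (W v.toNNReal) :=
        measurable_comap_apply (fun (u : Set.Iic s) ω ↦ W u ω)
          ⟨v.toNNReal, (Real.toNNReal_le_iff_le_coe.2 hv.2).trans hu⟩
      have e : W v.toNNReal = fun ω ↦ drivingPath κ σ (fun t ↦ θ t ω) v := by
        ext ω; simp [W, Real.coe_toNNReal v hv.1]
      rw [← e]
      exact this.mono le_sup_right le_rfl
    have h2 : Measurable[(MeasurableSpace.comap (θ 0) inferInstance) ⊔ (MeasurableSpace.pi.comap past)] (θ 0) :=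
      Measurable.mono (comap_measurable (θ 0)) le_sup_left le_rfl
    have e : θ u = fun ω ↦ Real.exp (κ * u) * ((Real.exp (-κ * (u : ℝ)) * θ (u : ℝ).toNNReal ω -
          Real.exp (-κ * (0 : ℝ)) * θ (0 : ℝ).toNNReal ω) + θ 0 ω) := by
      ext ω
      simp only [Real.toNNReal_coe, mul_zero, Real.exp_zero, one_mul, Real.toNNReal_zero,
        sub_add_cancel]
      rw [← mul_assoc, ← Real.exp_add]
      simp
    rw [e]
    exact Measurable.const_mul (Measurable.add h1 h2) _
  have hξ : Measurable[(MeasurableSpace.pi.comap inc)] fun ω ↦ Real.exp (-κ * t) * θ t ω - Real.exp (-κ * s) * θ s ω := by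
    have := measurable_exp_mul_sub (m := (MeasurableSpace.pi.comap inc)) (κ := κ) hσ hE.continuous_θ
      (NNReal.coe_le_coe.2 hst) fun v hv ↦ by
        have hv0 : (s : ℝ) ≤ v := hv.1
        have h1 : Measurable[(MeasurableSpace.pi.comap inc)] fun ω ↦ W (s + (v.toNNReal - s)) ω - W s ω :=
          measurable_comap_apply (fun u ω ↦ W (s + u) ω - W s ω) (v.toNNReal - s)
        have e : s + (v.toNNReal - s) = v.toNNReal :=
          add_tsub_cancel_of_le (NNReal.le_toNNReal_of_coe_le hv0)
        rw [e] at h1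
        simpa only [W, Real.coe_toNNReal v (s.2.trans hv0)] using h1
    simpa only [Real.toNNReal_coe] using this
  have key2 : Indep (history θ s) (MeasurableSpace.comap
      (fun ω ↦ Real.exp (-κ * t) * θ t ω - Real.exp (-κ * s) * θ s ω) inferInstance) P :=
    indep_of_indep_of_le key1 hhist hξ.comap_le
  have hYθ := hE.indep_Y_θ
  rw [IndepFun_iff_Indep] at hYθ
  have hθ' : ∀ u, Measurable[MeasurableSpace.comap (fun ω t ↦ θ t ω) inferInstance] (θ u) :=
    fun u ↦ measurable_comap_apply θ u
  refine indep_sup_left_of_indep (iSup_le fun u ↦ (hE.measurable_Y u).comap_le)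
    (history_le fun u _ ↦ hE.measurable_θ u)
    (Measurable.comap_le (((hE.measurable_θ t).const_mul _).sub ((hE.measurable_θ s).const_mul _)))
    (indep_of_indep_of_le hYθ ?_ ?_) key2
  · exact iSup_le fun u ↦ (measurable_comap_apply Y u).comap_le
  · refine sup_le (history_le fun u _ ↦ hθ' u) (Measurable.comap_le ?_)
    exact Measurable.sub (Measurable.const_mul (hθ' t) _) (Measurable.const_mul (hθ' s) _)

theorem IsEnvironment.memLp_increment_and_integral_eq_zero {Ω : Type*} [MeasurableSpace Ω]
    {P : Measure Ω} [IsProbabilityMeasure P] {κ σ μ₀ : ℝ} {σ₀ : ℝ≥0} {Z Y θ : ℝ≥0 → Ω → ℝ}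
    (hE : IsEnvironment P κ σ μ₀ σ₀ Z Y θ) (hσ : σ ≠ 0) {s t : ℝ≥0} (hst : s ≤ t) :
    MemLp (fun ω ↦ Real.exp (-κ * t) * θ t ω - Real.exp (-κ * s) * θ s ω) 2 P ∧
      ∫ ω, (Real.exp (-κ * t) * θ t ω - Real.exp (-κ * s) * θ s ω) ∂P = 0 := by
  let z : ℝ → Ω → ℝ := fun u ω ↦ drivingPath κ σ (fun t ↦ θ t ω) u
  have law : ∀ u : ℝ, s ≤ u → HasLaw (z u - z s) (gaussianReal 0 (u.toNNReal - s)) P := by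
    intro u hu
    have h := hE.brownian_Z.hasLaw_sub u.toNNReal s
    have e : nndist u.toNNReal.1 s.1 = u.toNNReal - s := by
      rw [← NNReal.coe_inj, coe_nndist, NNReal.coe_sub (NNReal.le_toNNReal_of_coe_le hu),
        Real.dist_eq]
      change |((u.toNNReal : ℝ) - (s : ℝ))| = _
      rw [Real.coe_toNNReal u (s.2.trans hu), abs_of_nonneg (sub_nonneg.2 hu)]
    rw [e] at h
    refine h.congr ?_
    filter_upwards [hE.ae_drivingPath_eq hσ] with ω h
    simp only [z, Pi.sub_apply]
    rw [h s, ← h u.toNNReal, Real.coe_toNNReal u (s.2.trans hu)]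
  have L2 : ∀ u : ℝ, s ≤ u → MemLp (z u - z s) 2 P := fun u hu ↦ by
    have h := memLp_id_gaussianReal (μ := 0) (v := u.toNNReal - s) 2
    rw [← (law u hu).map_eq] at h
    exact (memLp_map_measure_iff (by fun_prop) (law u hu).aemeasurable).1 h
  have mean : ∀ u : ℝ, s ≤ u → ∫ ω, (z u ω - z s ω) ∂P = 0 := fun u hu ↦ by
    have := (law u hu).integral_eq
    rw [integral_id_gaussianReal] at this
    exact this
  have sq : ∀ u : ℝ, s ≤ u →
      ∫⁻ ω, ‖z u ω - z s ω‖ₑ ^ (2 : ℝ) ∂P = ENNReal.ofReal (u - s) := by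
    intro u hu
    have h1 : ∫ ω, (z u ω - z s ω) ^ 2 ∂P = u - s := by
      have h := (law u hu).variance_eq
      rw [variance_id_gaussianReal, variance_eq_integral (law u hu).aemeasurable] at h
      have h0 : ∫ ω, (z u - z s) ω ∂P = 0 := mean u hu
      rw [h0] at h
      simp only [sub_zero, Pi.sub_apply] at h
      rw [h, NNReal.coe_sub (NNReal.le_toNNReal_of_coe_le hu), Real.coe_toNNReal u (s.2.trans hu)]
    rw [← h1, ofReal_integral_eq_lintegral_ofReal
      (f := fun ω ↦ (z u ω - z s ω) ^ 2) (L2 u hu).integrable_sq (Filter.Eventually.of_forall fun ω ↦ sq_nonneg _)]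
    refine lintegral_congr fun ω ↦ ?_
    rw [← ofReal_norm, ENNReal.ofReal_rpow_of_nonneg (norm_nonneg _) (by norm_num)]
    congr 1
    simp
  let f : ℝ → Ω → ℝ := fun u ω ↦ Real.exp (-κ * u) * (z u ω - z s ω)
  have fc : ∀ ω, Continuous fun u ↦ f u ω := fun ω ↦ by
    have := continuous_drivingPath κ σ (hE.continuous_θ ω)
    simp only [f, z]
    fun_prop
  have fm : ∀ u, Measurable (f u) := fun u ↦
    ((hE.measurable_drivingPath u).sub (hE.measurable_drivingPath s)).const_mul _
  let C : ℝ≥0∞ := ENNReal.ofReal (Real.exp (|κ| * t)) ^ (2 : ℝ) * ENNReal.ofReal (t - s)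
  have hC : C ≠ ∞ := ENNReal.mul_ne_top (by simp) (by simp)
  have fb : ∀ u ∈ Icc (s : ℝ) t, ∫⁻ ω, ‖f u ω‖ₑ ^ (2 : ℝ) ∂P ≤ C := by
    intro u hu
    have u0 : 0 ≤ u := s.2.trans hu.1
    simp only [f, enorm_mul]
    simp_rw [ENNReal.mul_rpow_of_nonneg _ _ (show (0 : ℝ) ≤ 2 by norm_num)]
    rw [lintegral_const_mul' _ _ (by simp), sq u hu.1]
    refine mul_le_mul' (ENNReal.rpow_le_rpow ?_ (by norm_num))
      (ENNReal.ofReal_le_ofReal (by linarith [hu.2]))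
    rw [← ofReal_norm, Real.norm_of_nonneg (Real.exp_pos _).le]
    refine ENNReal.ofReal_le_ofReal (Real.exp_le_exp.2 ?_)
    have := mul_le_mul_of_nonneg_right (neg_le_abs κ) u0
    have := mul_le_mul_of_nonneg_left hu.2 (abs_nonneg κ)
    linarith
  have hst' : (s : ℝ) ≤ t := NNReal.coe_le_coe.2 hst
  have f0 : ∀ u ∈ Icc (s : ℝ) t, ∫ ω, f u ω ∂P = 0 := fun u hu ↦ by
    simp only [f]
    rw [integral_const_mul, mean u hu.1, mul_zero]
  have i1 := memLp_two_intervalIntegral (P := P) fc fm hst' hC fb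
  have i2 := integral_intervalIntegral_eq_zero (P := P) fc fm hst' hC fb f0
  have e : (fun ω ↦ Real.exp (-κ * t) * θ t ω - Real.exp (-κ * s) * θ s ω) = fun ω ↦
      σ * (Real.exp (-κ * t) * (z t ω - z s ω) + κ * ∫ u in (s : ℝ)..t, f u ω) := by
    ext ω
    have := exp_mul_sub_exp_mul κ hσ (hE.continuous_θ ω) s t
    simpa only [Real.toNNReal_coe] using this
  have l1 : MemLp (fun ω ↦ Real.exp (-κ * t) * (z t ω - z s ω)) 2 P := (L2 t hst').const_mul _
  have l2 : MemLp (fun ω ↦ κ * ∫ u in (s : ℝ)..t, f u ω) 2 P := i1.const_mul κ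
  rw [e]
  refine ⟨(l1.add l2).const_mul σ, ?_⟩
  rw [integral_const_mul, integral_add (l1.integrable (by norm_num)) (l2.integrable (by norm_num)),
    integral_const_mul, integral_const_mul, i2, mean t hst']
  simp

/-! ### The signal: a bridge followed by the discounted state -/


/-- Adjoining an independent Gaussian variable to a Gaussian process gives a Gaussian process. -/
theorem isGaussianProcess_sumElim_const {Ω T : Type*} [MeasurableSpace Ω] {P : Measure Ω}
    {U : Ω → ℝ} {Y : T → Ω → ℝ} (hU : HasGaussianLaw U P) (hY : IsGaussianProcess Y P)
    (h : IndepFun U (fun ω t ↦ Y t ω) P) :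
    IsGaussianProcess (Sum.elim (fun _ : Unit ↦ U) Y) P where
  hasGaussianLaw I := by
    classical
    let J : Finset T := I.toRight
    have hJ : HasGaussianLaw (fun ω ↦ (U ω, J.restrict (Y · ω))) P := by
      refine IndepFun.hasGaussianLaw hU (hY.hasGaussianLaw J) ?_
      exact h.comp (φ := id) (ψ := J.restrict) measurable_id (Finset.measurable_restrict J)
    let L : (ℝ × (J → ℝ)) →L[ℝ] (I → ℝ) := ContinuousLinearMap.pi fun i ↦
      match i with
      | ⟨.inl _, _⟩ => ContinuousLinearMap.fst ℝ _ _
      | ⟨.inr t, ht⟩ => (ContinuousLinearMap.proj (R := ℝ) (φ := fun _ : J ↦ ℝ)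
          (⟨t, Finset.mem_toRight.2 ht⟩ : J)).comp (ContinuousLinearMap.snd ℝ _ _)
    convert! hJ.map L using 1
    ext ω ⟨i, hi⟩
    cases i <;> rfl

/-- The bridge `u (θ₀ - μ₀) + σ₀ (Y_u - u Y_1)` on `[0, 1]`. It is a Brownian motion with variance
`σ₀² u` that reveals the initial state gradually: it vanishes at `0` and is `θ₀ - μ₀` at `1`. -/
noncomputable def initialBridge {Ω : Type*} (μ₀ : ℝ) (σ₀ : ℝ≥0) (Y θ : ℝ≥0 → Ω → ℝ) (u : ℝ≥0)
    (ω : Ω) : ℝ :=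
  u * (θ 0 ω - μ₀) + σ₀ * (Y u ω - u * Y 1 ω)

/-- The signal through which the sender reveals information, indexed by signal time `a ∈ [-1, ∞)`.
On `[-1, 0]` it is the bridge that reveals `θ₀`; from then on it is the discounted state
`e^{-κa} θ_a`, centered at `μ₀`. The clipping extends it to all of `ℝ`, constant before `-1`. -/
noncomputable def signal {Ω : Type*} (κ μ₀ : ℝ) (σ₀ : ℝ≥0) (Y θ : ℝ≥0 → Ω → ℝ) (a : ℝ)
    (ω : Ω) : ℝ :=
  initialBridge μ₀ σ₀ Y θ (min 1 (1 + a).toNNReal) ω +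
    (Real.exp (-κ * a.toNNReal) * θ a.toNNReal ω - θ 0 ω)

/-- The information `σ(X_e : e ≤ a)` in a process indexed by the real line. -/
abbrev past {Ω : Type*} (X : ℝ → Ω → ℝ) (a : ℝ) : MeasurableSpace Ω :=
  ⨆ e : ℝ, ⨆ _ : e ≤ a, MeasurableSpace.comap (X e) inferInstance

theorem measurable_past {Ω : Type*} (X : ℝ → Ω → ℝ) {a e : ℝ} (h : e ≤ a) :
    Measurable[past X a] (X e) :=
  Measurable.mono (comap_measurable (X e)) (le_iSup₂_of_le (f := fun v (_ : v ≤ a) ↦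
    MeasurableSpace.comap (X v) inferInstance) e h le_rfl) le_rfl

/-- What the construction of decision rules uses about the signal: it is a continuous centered
square-integrable process with independent increments, started at `0` at signal time `-1`,
adapted to the sender's information, and equal to the centered discounted state on `[0, ∞)`, where
its increments are independent of the sender's information and not only of its own past. -/
structure IsSignal {Ω : Type*} [MeasurableSpace Ω] (P : Measure Ω) (κ μ₀ : ℝ)
    (Y θ : ℝ≥0 → Ω → ℝ) (X : ℝ → Ω → ℝ) : Prop where
  adapted : ∀ (a : ℝ) (t : ℝ≥0), a ≤ t → Measurable[senderInfo Y θ t] (X a)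
  measurable : ∀ a, Measurable (X a)
  continuous : ∀ ω, Continuous fun a ↦ X a ω
  memLp : ∀ a, MemLp (X a) 2 P
  mean : ∀ a, ∫ ω, X a ω ∂P = 0
  start : ∀ᵐ ω ∂P, X (-1) ω = 0
  indep : ∀ a c, a ≤ c →
    Indep (past X a) (MeasurableSpace.comap (fun ω ↦ X c ω - X a ω) inferInstance) P
  indep_senderInfo : ∀ s t : ℝ≥0, s ≤ t → Indep (senderInfo Y θ s)
    (MeasurableSpace.comap (fun ω ↦ X t ω - X s ω) inferInstance) P
  state : ∀ (t : ℝ≥0) (ω : Ω), X t ω = Real.exp (-κ * t) * θ t ω - μ₀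

theorem IsEnvironment.memLp_state_zero {Ω : Type*} [MeasurableSpace Ω] {P : Measure Ω}
    {κ σ μ₀ : ℝ} {σ₀ : ℝ≥0} {Z Y θ : ℝ≥0 → Ω → ℝ}
    (hE : IsEnvironment P κ σ μ₀ σ₀ Z Y θ) : MemLp (θ 0) 2 P := by
  have h := memLp_id_gaussianReal (μ := μ₀) (v := σ₀ ^ 2) 2
  rw [← hE.law_θ_zero.map_eq] at h
  exact (memLp_map_measure_iff (by fun_prop) hE.law_θ_zero.aemeasurable).1 h

theorem covariance_initialBridge {Ω : Type*} [MeasurableSpace Ω] {P : Measure Ω}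
    [IsProbabilityMeasure P] {κ σ μ₀ : ℝ} {σ₀ : ℝ≥0} {Z Y θ : ℝ≥0 → Ω → ℝ}
    (hE : IsEnvironment P κ σ μ₀ σ₀ Z Y θ) {u v : ℝ≥0} (huv : u ≤ v) (hv : v ≤ 1) :
    cov[initialBridge μ₀ σ₀ Y θ v, initialBridge μ₀ σ₀ Y θ u; P] = σ₀ ^ 2 * u := by
  have hθ : MemLp (θ 0) 2 P := hE.memLp_state_zero
  have hU : MemLp (fun ω ↦ θ 0 ω - μ₀) 2 P := hθ.sub (memLp_const μ₀)
  have hY : ∀ t, MemLp (Y t) 2 P := fun t ↦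
    (hE.brownian_Y.isGaussianProcess.hasGaussianLaw_eval t).memLp_two
  have hYu : ∀ t : ℝ≥0, MemLp (fun ω ↦ t * Y 1 ω) 2 P := fun t ↦ (hY 1).const_mul _
  have hB : ∀ t : ℝ≥0, MemLp (fun ω ↦ Y t ω - t * Y 1 ω) 2 P := fun t ↦ (hY t).sub (hYu t)
  have hYθ : ∀ t, cov[fun ω ↦ θ 0 ω - μ₀, fun ω ↦ Y t ω; P] = 0 := fun t ↦ by
    rw [covariance_sub_const_left (hθ.integrable (by norm_num))]
    have hi : IndepFun (θ 0) (Y t) P :=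
      (hE.indep_Y_θ.comp (φ := fun y : ℝ≥0 → ℝ ↦ y t) (ψ := fun x : ℝ≥0 → ℝ ↦ x 0)
        (by fun_prop) (by fun_prop)).symm
    exact hi.covariance_eq_zero hθ (hY t)
  have hvar : cov[fun ω ↦ θ 0 ω - μ₀, fun ω ↦ θ 0 ω - μ₀; P] = σ₀ ^ 2 := by
    rw [covariance_self hU.aestronglyMeasurable.aemeasurable,
      variance_sub_const hθ.aestronglyMeasurable, hE.law_θ_zero.variance_eq,
      variance_id_gaussianReal]
    simp
  have hcB : ∀ t : ℝ≥0, cov[fun ω ↦ θ 0 ω - μ₀, fun ω ↦ Y t ω - t * Y 1 ω; P] = 0 := fun t ↦ by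
    rw [covariance_fun_sub_right hU (hY t) (hYu t), covariance_const_mul_right, hYθ, hYθ]
    simp
  have hBB : cov[fun ω ↦ Y v ω - v * Y 1 ω, fun ω ↦ Y u ω - u * Y 1 ω; P] = u - u * v := by
    rw [covariance_fun_sub_left (hY v) (hYu v) (hB u),
      covariance_fun_sub_right (hY v) (hY u) (hYu u),
      covariance_fun_sub_right (hYu v) (hY u) (hYu u)]
    simp only [covariance_const_mul_left, covariance_const_mul_right,
      hE.brownian_Y.covariance_fun_eval]
    rw [min_eq_right huv, min_eq_left hv, min_eq_right (huv.trans hv), min_self]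
    push_cast
    ring
  have e : ∀ t : ℝ≥0, initialBridge μ₀ σ₀ Y θ t =
    (fun ω ↦ t * (θ 0 ω - μ₀)) + fun ω ↦ σ₀ * (Y t ω - t * Y 1 ω) := fun t ↦ rfl
  rw [e, e, covariance_add_left (hU.const_mul _) ((hB v).const_mul _)
      ((hU.const_mul _).add ((hB u).const_mul _)),
    covariance_add_right (hU.const_mul _) (hU.const_mul _) ((hB u).const_mul _),
    covariance_add_right ((hB v).const_mul _) (hU.const_mul _) ((hB u).const_mul _)]
  simp only [covariance_const_mul_left, covariance_const_mul_right]
  rw [covariance_comm (fun ω ↦ Y v ω - v * Y 1 ω) (fun ω ↦ θ 0 ω - μ₀), hcB, hcB, hvar, hBB]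
  ring

theorem IsEnvironment.indep_initialBridge {Ω : Type*} [mΩ : MeasurableSpace Ω] {P : Measure Ω}
    [IsProbabilityMeasure P] {κ σ μ₀ : ℝ} {σ₀ : ℝ≥0} {Z Y θ : ℝ≥0 → Ω → ℝ}
    (hE : IsEnvironment P κ σ μ₀ σ₀ Z Y θ) {u v : ℝ≥0} (huv : u ≤ v) (hv : v ≤ 1) :
    Indep (MeasurableSpace.comap (fun ω (e : Iic u) ↦ initialBridge μ₀ σ₀ Y θ e ω) inferInstance)
      (MeasurableSpace.comap (fun ω ↦ initialBridge μ₀ σ₀ Y θ v ω - initialBridge μ₀ σ₀ Y θ u ω)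
        inferInstance) P := by
  classical
  have hθ : MemLp (θ 0) 2 P := hE.memLp_state_zero
  have hUlaw : HasGaussianLaw (fun ω ↦ θ 0 ω - μ₀) P := by
    have := gaussianReal_sub_const hE.law_θ_zero μ₀
    exact this.hasGaussianLaw
  have hbase := isGaussianProcess_sumElim_const hUlaw hE.brownian_Y.isGaussianProcess
    (hE.indep_Y_θ.symm.comp (φ := fun x : ℝ≥0 → ℝ ↦ x 0 - μ₀) (ψ := id)
      (by fun_prop) measurable_id)
  set B : Unit ⊕ ℝ≥0 → Ω → ℝ := Sum.elim (fun _ ω ↦ θ 0 ω - μ₀) Y with hB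
  -- Bridge values are linear functionals of `θ₀ - μ₀`, `Y_e` and `Y_1`.
  let J : ℝ≥0 → Finset ((Unit ⊕ ℝ≥0)) := fun e ↦ {.inl (), .inr e, .inr 1}
  let L : ∀ (e : ℝ≥0) (I : Finset ((Unit ⊕ ℝ≥0))), J e ⊆ I → (I → ℝ) →L[ℝ] ℝ := fun e I h ↦
    (e : ℝ) • ContinuousLinearMap.proj (R := ℝ) (φ := fun _ : I ↦ ℝ) ⟨.inl (), h (by simp [J])⟩ +
      (σ₀ : ℝ) • (ContinuousLinearMap.proj (R := ℝ) (φ := fun _ : I ↦ ℝ)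
        ⟨.inr e, h (by simp [J])⟩ -
        (e : ℝ) • ContinuousLinearMap.proj (R := ℝ) (φ := fun _ : I ↦ ℝ)
          ⟨.inr 1, h (by simp [J])⟩)
  have hL : ∀ e I h ω, initialBridge μ₀ σ₀ Y θ e ω = L e I h (I.restrict (B · ω)) := by
    intro e I h ω
    simp [L, initialBridge, B]
  have hG : IsGaussianProcess (initialBridge μ₀ σ₀ Y θ) P :=
    hbase.of_isGaussianProcess fun e ↦ ⟨J e, L e (J e) le_rfl, hL e _ _⟩
  have hm : ∀ e, Measurable (initialBridge μ₀ σ₀ Y θ e) := fun e ↦ by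
    have h1 := hE.measurable_θ 0
    have h2 := hE.measurable_Y e
    have h3 := hE.measurable_Y 1
    unfold initialBridge
    fun_prop
  have h2 : ∀ e, MemLp (initialBridge μ₀ σ₀ Y θ e) 2 P := fun e ↦
    (hG.hasGaussianLaw_eval e).memLp_two
  have hpair : IsGaussianProcess (Sum.elim
      (fun (e : Iic u) ω ↦ initialBridge μ₀ σ₀ Y θ e ω)
      (fun (_ : Unit) ω ↦ initialBridge μ₀ σ₀ Y θ v ω - initialBridge μ₀ σ₀ Y θ u ω)) P := by
    refine hbase.of_isGaussianProcess ?_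
    rintro (e | _)
    · exact ⟨J e, L e (J e) le_rfl, hL e _ _⟩
    · refine ⟨J v ∪ J u, L v _ Finset.subset_union_left - L u _ Finset.subset_union_right,
        fun ω ↦ ?_⟩
      rw [sub_apply, ← hL, ← hL]
      rfl
  have hind := hpair.indepFun_of_covariance_eq_zero (fun e ↦ (hm e).aemeasurable)
    (fun _ ↦ ((hm v).sub (hm u)).aemeasurable) (fun e _ ↦ by
      have he : (e : ℝ≥0) ≤ u := e.2
      rw [covariance_fun_sub_right (h2 e) (h2 v) (h2 u), covariance_comm _ (fun ω ↦ _),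
        covariance_comm _ (fun ω ↦ initialBridge μ₀ σ₀ Y θ u ω)]
      erw [covariance_initialBridge hE (he.trans huv) hv,
        covariance_initialBridge hE he (huv.trans hv)]
      simp)
  rw [IndepFun_iff_Indep] at hind
  exact indep_of_indep_of_le_right hind (measurable_comap_apply (fun (_ : Unit) ω ↦
    initialBridge μ₀ σ₀ Y θ v ω - initialBridge μ₀ σ₀ Y θ u ω) ()).comap_le

theorem IsEnvironment.isSignal_signal {Ω : Type*} [mΩ : MeasurableSpace Ω] {P : Measure Ω}
    [IsProbabilityMeasure P] {κ σ μ₀ : ℝ} {σ₀ : ℝ≥0} {Z Y θ : ℝ≥0 → Ω → ℝ}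
    (hE : IsEnvironment P κ σ μ₀ σ₀ Z Y θ) (hσ : σ ≠ 0) :
    IsSignal P κ μ₀ Y θ (signal κ μ₀ σ₀ Y θ) := by
  have bridge_sender : ∀ (e t : ℝ≥0), Measurable[senderInfo Y θ t] (initialBridge μ₀ σ₀ Y θ e) := by
    intro e t
    exact Measurable.add (Measurable.const_mul (Measurable.sub_const
        (measurable_senderInfo_state Y θ (zero_le (a := t))) _) _)
      (Measurable.const_mul (Measurable.sub (measurable_senderInfo_device Y θ e t)
        (Measurable.const_mul (measurable_senderInfo_device Y θ 1 t) _)) _)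
  have bridge_meas : ∀ e, Measurable (initialBridge μ₀ σ₀ Y θ e) := fun e ↦
    (bridge_sender e 0).mono (hE.senderInfo_le 0) le_rfl
  have adapted : ∀ (a : ℝ) (t : ℝ≥0), a ≤ t →
      Measurable[senderInfo Y θ t] (signal κ μ₀ σ₀ Y θ a) := by
    intro a t hat
    exact Measurable.add (bridge_sender _ t) (Measurable.sub (Measurable.const_mul
      (measurable_senderInfo_state Y θ (Real.toNNReal_le_iff_le_coe.2 hat)) _)
      (measurable_senderInfo_state Y θ (zero_le (a := t))))
  have meas : ∀ a, Measurable (signal κ μ₀ σ₀ Y θ a) := fun a ↦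
    (adapted a a.toNNReal (Real.le_coe_toNNReal a)).mono (hE.senderInfo_le _) le_rfl
  have hθ : MemLp (θ 0) 2 P := hE.memLp_state_zero
  have hθm : ∫ ω, θ 0 ω ∂P = μ₀ := by
    rw [hE.law_θ_zero.integral_eq, integral_id_gaussianReal]
  have hYL : ∀ u, MemLp (Y u) 2 P := fun u ↦
    (hE.brownian_Y.isGaussianProcess.hasGaussianLaw_eval u).memLp_two
  have hYm : ∀ u, ∫ ω, Y u ω ∂P = 0 := hE.brownian_Y.integral_eval
  have l1 : ∀ e : ℝ≥0, MemLp (fun ω ↦ (e : ℝ) * (θ 0 ω - μ₀)) 2 P := fun e ↦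
    (hθ.sub (memLp_const μ₀)).const_mul _
  have l2 : ∀ e : ℝ≥0, MemLp (fun ω ↦ (σ₀ : ℝ) * (Y e ω - e * Y 1 ω)) 2 P := fun e ↦
    ((hYL e).sub ((hYL 1).const_mul _)).const_mul _
  have bridge_memLp : ∀ e, MemLp (initialBridge μ₀ σ₀ Y θ e) 2 P := fun e ↦ (l1 e).add (l2 e)
  have bridge_mean : ∀ e, ∫ ω, initialBridge μ₀ σ₀ Y θ e ω ∂P = 0 := fun e ↦ by
    simp only [initialBridge]
    rw [integral_add ((l1 e).integrable (by norm_num)) ((l2 e).integrable (by norm_num)),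
      integral_const_mul, integral_const_mul,
      integral_sub (hθ.integrable (by norm_num)) (integrable_const _),
      integral_sub ((hYL e).integrable (by norm_num))
        (((hYL 1).integrable (by norm_num)).const_mul _), integral_const_mul, hYm, hYm, hθm]
    simp
  have inc : ∀ t : ℝ≥0, MemLp (fun ω ↦ Real.exp (-κ * t) * θ t ω - θ 0 ω) 2 P ∧
      ∫ ω, (Real.exp (-κ * t) * θ t ω - θ 0 ω) ∂P = 0 := fun t ↦ by
    simpa using hE.memLp_increment_and_integral_eq_zero hσ (zero_le (a := t))
  have sig_nonpos : ∀ a ≤ 0, signal κ μ₀ σ₀ Y θ a =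
      initialBridge μ₀ σ₀ Y θ (min 1 (1 + a).toNNReal) := fun a ha ↦ by
    ext ω
    simp [signal, Real.toNNReal_of_nonpos ha]
  have sig_nonneg : ∀ a, 0 ≤ a → ∀ ω, signal κ μ₀ σ₀ Y θ a ω =
      Real.exp (-κ * a.toNNReal) * θ a.toNNReal ω - μ₀ := fun a ha ω ↦ by
    have : min 1 (1 + a).toNNReal = 1 := min_eq_left (by simpa using ha)
    simp only [signal, initialBridge, this]
    push_cast
    ring
  have state : ∀ (t : ℝ≥0) (ω : Ω),
      signal κ μ₀ σ₀ Y θ t ω = Real.exp (-κ * t) * θ t ω - μ₀ := fun t ω ↦ by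
    simpa only [Real.toNNReal_coe] using sig_nonneg t t.2 ω
  refine ⟨adapted, meas, ?_, ?_, ?_, ?_, ?_, fun s t hst ↦ ?_, state⟩
  · intro ω
    have h1 := hE.continuous_θ ω
    have h2 := hE.continuous_Y ω
    unfold signal initialBridge
    have h3 : Continuous fun a : ℝ ↦ min 1 (1 + a).toNNReal := by fun_prop
    have h4 := h2.comp h3
    have h5 := h1.comp continuous_real_toNNReal
    simp only [Function.comp_def] at h4 h5
    fun_prop
  · exact fun a ↦ (bridge_memLp _).add (inc a.toNNReal).1
  · intro a
    simp only [signal]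
    rw [integral_add ((bridge_memLp _).integrable (by norm_num))
      ((inc a.toNNReal).1.integrable (by norm_num)), bridge_mean, (inc _).2, add_zero]
  · filter_upwards [hE.brownian_Y.eval_zero_ae_eq_zero] with ω h
    rw [sig_nonpos _ (by norm_num)]
    simp [initialBridge, h]
  · intro a c hac
    rcases le_or_gt 0 a with ha | ha
    · have h := hE.indep_increment hσ (Real.toNNReal_le_toNNReal hac)
      refine indep_of_indep_of_le h ?_ ?_
      · exact iSup₂_le fun e he ↦
          (adapted e _ (he.trans (Real.le_coe_toNNReal a))).comap_le
      · have e : (fun ω ↦ signal κ μ₀ σ₀ Y θ c ω - signal κ μ₀ σ₀ Y θ a ω) = fun ω ↦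
            Real.exp (-κ * c.toNNReal) * θ c.toNNReal ω -
              Real.exp (-κ * a.toNNReal) * θ a.toNNReal ω := by
          ext ω
          rw [sig_nonneg c (ha.trans hac), sig_nonneg a ha]
          ring
        rw [e]
    -- Before signal time `0`, the increment is one of the bridge plus one of the discounted state
    -- from time `0` on, which are independent of each other and of the bridge so far.
    · set u := min 1 (1 + a).toNNReal with hu
      set v := min 1 (1 + c).toNNReal with hv
      have huv : u ≤ v := min_le_min le_rfl (Real.toNNReal_le_toNNReal (by linarith))
      have hb := hE.indep_initialBridge huv (min_le_left _ _)
      have hx := hE.indep_increment hσ (zero_le (a := c.toNNReal))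
      simp only [NNReal.coe_zero, mul_zero, Real.exp_zero, one_mul] at hx
      let f : Ω → Iic u → ℝ := fun ω e ↦ initialBridge μ₀ σ₀ Y θ e ω
      let g : Ω → ℝ := fun ω ↦ initialBridge μ₀ σ₀ Y θ v ω - initialBridge μ₀ σ₀ Y θ u ω
      let ξ : Ω → ℝ := fun ω ↦ Real.exp (-κ * c.toNNReal) * θ c.toNNReal ω - θ 0 ω
      have hf : Measurable f := measurable_pi_lambda _ fun e ↦ bridge_meas e
      have hf0 : Measurable[senderInfo Y θ 0] f :=
        @measurable_pi_lambda _ _ _ (_) _ _ fun e ↦ bridge_sender e 0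
      have hg : Measurable g := (bridge_meas v).sub (bridge_meas u)
      have hg0 : Measurable[senderInfo Y θ 0] g :=
        Measurable.sub (bridge_sender v 0) (bridge_sender u 0)
      have hξ : Measurable ξ := ((hE.measurable_θ _).const_mul _).sub (hE.measurable_θ 0)
      have h3 : Indep (MeasurableSpace.comap f inferInstance)
          (MeasurableSpace.comap g inferInstance ⊔ MeasurableSpace.comap ξ inferInstance) P :=
        indep_sup_right_of_indep hf.comap_le hg.comap_le hξ.comap_le
          (indep_of_indep_of_le_left hx (sup_le hf0.comap_le hg0.comap_le)) hb
      refine indep_of_indep_of_le h3 ?_ (Measurable.comap_le ?_)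
      · refine iSup₂_le fun e he ↦ Measurable.comap_le ?_
        rw [sig_nonpos e (he.trans ha.le)]
        exact measurable_comap_apply (fun (e : Iic u) ω ↦ initialBridge μ₀ σ₀ Y θ e ω)
          ⟨min 1 (1 + e).toNNReal, min_le_min le_rfl (Real.toNNReal_le_toNNReal (by linarith))⟩
      · have e : (fun ω ↦ signal κ μ₀ σ₀ Y θ c ω - signal κ μ₀ σ₀ Y θ a ω) =
            fun ω ↦ g ω + ξ ω := by
          ext ω
          rw [sig_nonpos a ha.le]
          simp only [signal, g, ξ, ← hu, ← hv]
          ring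
        rw [e]
        exact Measurable.add ((comap_measurable g).mono le_sup_left le_rfl)
          ((comap_measurable ξ).mono le_sup_right le_rfl)
  · simpa only [state, sub_sub_sub_cancel_right] using hE.indep_increment hσ hst

/-! ### Releasing the signal by a clock -/


/-- Independent increments are orthogonal to the past, so their second moment is the increment of
the second moment of the process. -/
theorem IsSignal.integral_sub_sq {Ω : Type*} [mΩ : MeasurableSpace Ω] {P : Measure Ω}
    [IsProbabilityMeasure P] {κ μ₀ : ℝ} {Y θ : ℝ≥0 → Ω → ℝ} {X : ℝ → Ω → ℝ}
    (hX : IsSignal P κ μ₀ Y θ X) {a c : ℝ} (hac : a ≤ c) :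
    ∫ ω, (X c ω - X a ω) ^ 2 ∂P = ∫ ω, X c ω ^ 2 ∂P - ∫ ω, X a ω ^ 2 ∂P := by
  have hi : IndepFun (X a) (fun ω ↦ X c ω - X a ω) P := by
    rw [IndepFun_iff_Indep]
    exact indep_of_indep_of_le_left (hX.indep a c hac) (measurable_past X le_rfl).comap_le
  have hd : MemLp (fun ω ↦ X c ω - X a ω) 2 P := (hX.memLp c).sub (hX.memLp a)
  have h0 : ∫ ω, X a ω * (X c ω - X a ω) ∂P = 0 := by
    rw [hi.integral_fun_mul_eq_mul_integral (hX.memLp a).aestronglyMeasurable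
      hd.aestronglyMeasurable, hX.mean, zero_mul]
  have i1 : Integrable (fun ω ↦ X a ω * (X c ω - X a ω)) P := (hX.memLp a).integrable_mul hd
  have e : ∀ ω, (X c ω - X a ω) ^ 2 =
      X c ω ^ 2 - X a ω ^ 2 - 2 * (X a ω * (X c ω - X a ω)) := fun ω ↦ by ring
  simp_rw [e]
  rw [integral_sub (f := fun ω ↦ X c ω ^ 2 - X a ω ^ 2)
    ((hX.memLp c).integrable_sq.sub (hX.memLp a).integrable_sq) (i1.const_mul 2),
    integral_sub (hX.memLp c).integrable_sq (hX.memLp a).integrable_sq, integral_const_mul, h0]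
  ring

theorem IsSignal.monotone_integral_sq {Ω : Type*} [mΩ : MeasurableSpace Ω] {P : Measure Ω}
    [IsProbabilityMeasure P] {κ μ₀ : ℝ} {Y θ : ℝ≥0 → Ω → ℝ} {X : ℝ → Ω → ℝ}
    (hX : IsSignal P κ μ₀ Y θ X) : Monotone fun a ↦ ∫ ω, X a ω ^ 2 ∂P := fun a c hac ↦ by
  have h := hX.integral_sub_sq hac
  have : 0 ≤ ∫ ω, (X c ω - X a ω) ^ 2 ∂P := integral_nonneg fun ω ↦ sq_nonneg _
  simp only
  linarith

/-- Fatou's lemma for second moments of increments of a process with continuous paths. -/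
theorem IsSignal.integral_sub_sq_le_of_tendsto {Ω : Type*} [mΩ : MeasurableSpace Ω]
    {P : Measure Ω} [IsProbabilityMeasure P] {κ μ₀ : ℝ} {Y θ : ℝ≥0 → Ω → ℝ} {X : ℝ → Ω → ℝ}
    (hX : IsSignal P κ μ₀ Y θ X) {a c M : ℝ} (hM : 0 ≤ M) {u : ℕ → ℝ}
    (hu : Filter.Tendsto u Filter.atTop (nhds c))
    (h : ∀ n, ∫ ω, (X (u n) ω - X a ω) ^ 2 ∂P ≤ M) : ∫ ω, (X c ω - X a ω) ^ 2 ∂P ≤ M := by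
  have e : ∀ c, ENNReal.ofReal (∫ ω, (X c ω - X a ω) ^ 2 ∂P) =
      ∫⁻ ω, ENNReal.ofReal ((X c ω - X a ω) ^ 2) ∂P := fun c ↦
    ofReal_integral_eq_lintegral_ofReal ((hX.memLp c).sub (hX.memLp a)).integrable_sq
      (Filter.Eventually.of_forall fun ω ↦ sq_nonneg _)
  rw [← ENNReal.ofReal_le_ofReal_iff hM, e]
  have lim : ∀ ω, Filter.Tendsto (fun n ↦ ENNReal.ofReal ((X (u n) ω - X a ω) ^ 2)) Filter.atTop
      (nhds (ENNReal.ofReal ((X c ω - X a ω) ^ 2))) := fun ω ↦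
    ENNReal.tendsto_ofReal (((((hX.continuous ω).tendsto c).comp hu).sub_const _).pow 2)
  calc ∫⁻ ω, ENNReal.ofReal ((X c ω - X a ω) ^ 2) ∂P
      = ∫⁻ ω, Filter.liminf (fun n ↦ ENNReal.ofReal ((X (u n) ω - X a ω) ^ 2)) Filter.atTop ∂P :=
        lintegral_congr fun ω ↦ (lim ω).liminf_eq.symm
    _ ≤ Filter.liminf (fun n ↦ ∫⁻ ω, ENNReal.ofReal ((X (u n) ω - X a ω) ^ 2) ∂P) Filter.atTop :=
        lintegral_liminf_le fun n ↦
          (((hX.measurable _).sub (hX.measurable _)).pow_const 2).ennreal_ofReal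
    _ ≤ ENNReal.ofReal M := by
        refine Filter.liminf_le_of_le (by isBoundedDefault) fun x hx ↦ ?_
        obtain ⟨n, hn⟩ := hx.exists
        exact hn.trans ((e (u n)).symm.le.trans (ENNReal.ofReal_le_ofReal (h n)))

/-- The variance of the signal is continuous in signal time. Path continuity and orthogonality of
increments suffice: the one-sided limits of the monotone variance function are bounded through
Fatou's lemma. -/
theorem IsSignal.continuous_integral_sq {Ω : Type*} [mΩ : MeasurableSpace Ω] {P : Measure Ω}
    [IsProbabilityMeasure P] {κ μ₀ : ℝ} {Y θ : ℝ≥0 → Ω → ℝ} {X : ℝ → Ω → ℝ}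
    (hX : IsSignal P κ μ₀ Y θ X) : Continuous fun a ↦ ∫ ω, X a ω ^ 2 ∂P := by
  set S : ℝ → ℝ := fun a ↦ ∫ ω, X a ω ^ 2 ∂P with hS
  have hmono : Monotone S := hX.monotone_integral_sq
  have hsub : ∀ a c, a ≤ c → ∫ ω, (X c ω - X a ω) ^ 2 ∂P = S c - S a := fun a c ↦
    hX.integral_sub_sq
  refine continuous_iff_continuousAt.2 fun c ↦ ?_
  rw [hmono.continuousAt_iff_leftLim_eq_rightLim]
  have hlow : Filter.Tendsto (fun n : ℕ ↦ c - 1 / ((n : ℝ) + 1)) Filter.atTop (nhds c) := by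
    simpa using (tendsto_one_div_add_atTop_nhds_zero_nat (𝕜 := ℝ)).const_sub c
  have hup : Filter.Tendsto (fun n : ℕ ↦ c + 1 / ((n : ℝ) + 1)) Filter.atTop (nhds c) := by
    simpa using (tendsto_one_div_add_atTop_nhds_zero_nat (𝕜 := ℝ)).const_add c
  have hpos : ∀ n : ℕ, 0 < 1 / ((n : ℝ) + 1) := fun n ↦ by positivity
  have h1 : S c ≤ Function.leftLim S c := by
    have ha : c - 1 < c := by linarith
    have : ∫ ω, (X c ω - X (c - 1) ω) ^ 2 ∂P ≤ Function.leftLim S c - S (c - 1) := by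
      refine hX.integral_sub_sq_le_of_tendsto (sub_nonneg.2 (hmono.le_leftLim ha)) hlow fun n ↦ ?_
      have : 1 / ((n : ℝ) + 1) ≤ 1 := by
        rw [div_le_one (by positivity)]; linarith [(Nat.cast_nonneg n : (0 : ℝ) ≤ n)]
      rw [hsub _ _ (by linarith)]
      have := hmono.le_leftLim (show c - 1 / ((n : ℝ) + 1) < c by linarith [hpos n])
      linarith
    rw [hsub _ _ ha.le] at this
    linarith
  have h2 : Function.rightLim S c ≤ S c := by
    have ha : c < c + 1 := by linarith
    have : ∫ ω, (X c ω - X (c + 1) ω) ^ 2 ∂P ≤ S (c + 1) - Function.rightLim S c := by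
      refine hX.integral_sub_sq_le_of_tendsto (sub_nonneg.2 (hmono.rightLim_le ha)) hup fun n ↦ ?_
      have : 1 / ((n : ℝ) + 1) ≤ 1 := by
        rw [div_le_one (by positivity)]; linarith [(Nat.cast_nonneg n : (0 : ℝ) ≤ n)]
      have h := hsub (c + 1 / ((n : ℝ) + 1)) (c + 1) (by linarith)
      simp_rw [fun ω ↦ sub_sq_comm (X (c + 1 / ((n : ℝ) + 1)) ω)]
      rw [h]
      have := hmono.rightLim_le (show c < c + 1 / ((n : ℝ) + 1) by linarith [hpos n])
      linarith
    simp_rw [fun ω ↦ sub_sq_comm (X c ω)] at this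
    rw [hsub _ _ ha.le] at this
    linarith
  exact le_antisymm (hmono.leftLim_le_rightLim le_rfl) (h2.trans h1)

/-- A right-continuous monotone amount `p` of information can be released by running a clock `τ`
that never overtakes calendar time: if `S` is the amount available, `S (τ t) = p t`. -/
theorem exists_clock {S : ℝ → ℝ} (hS : Continuous S) (hmono : Monotone S) (hS0 : S (-1) = 0)
    {p : ℝ≥0 → ℝ} (hp : Monotone p) (hp_rc : ∀ t, ContinuousWithinAt p (Ici t) t)
    (hp0 : ∀ t, 0 ≤ p t) (hpS : ∀ t : ℝ≥0, p t ≤ S t) :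
    ∃ τ : ℝ≥0 → ℝ, Monotone τ ∧ (∀ t, ContinuousWithinAt τ (Ici t) t) ∧
      (∀ t : ℝ≥0, τ t ≤ t) ∧ ∀ t, S (τ t) = p t := by
  -- The largest solution of `S a = p t` in `[-1, t]`; being the largest makes it right-continuous.
  let K : ℝ≥0 → Set ℝ := fun t ↦ {a | -1 ≤ a ∧ a ≤ t ∧ S a ≤ p t}
  have hK : ∀ t, -1 ∈ K t := fun t ↦
    ⟨le_rfl, by linarith [(show (0 : ℝ) ≤ t from t.2)], by rw [hS0]; exact hp0 t⟩
  have hne : ∀ t, (K t).Nonempty := fun t ↦ ⟨-1, hK t⟩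
  have hbd : ∀ t, BddAbove (K t) := fun t ↦ ⟨t, fun a ha ↦ ha.2.1⟩
  have hmem : ∀ t, sSup (K t) ∈ K t := fun t ↦ by
    have hc : IsClosed (K t) :=
      (isClosed_le continuous_const continuous_id).inter
        ((isClosed_le continuous_id continuous_const).inter (isClosed_le hS continuous_const))
    exact hc.csSup_mem (hne t) (hbd t)
  have hτ : Monotone fun t ↦ sSup (K t) := fun s t hst ↦
    csSup_le_csSup (hbd t) (hne s) fun a ha ↦
      ⟨ha.1, ha.2.1.trans (NNReal.coe_le_coe.2 hst), ha.2.2.trans (hp hst)⟩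
  refine ⟨fun t ↦ sSup (K t), hτ, fun t ↦ ?_, fun t ↦ (hmem t).2.1, fun t ↦ ?_⟩
  · refine tendsto_order.2 ⟨fun c hc ↦ ?_, fun c hc ↦ ?_⟩
    · filter_upwards [self_mem_nhdsWithin] with s hs
      exact hc.trans_le (hτ hs)
    · obtain ⟨d, hd, hdc⟩ := exists_between hc
      rcases lt_or_ge (t : ℝ) d with htd | htd
      · have : ∀ᶠ s : ℝ≥0 in nhds t, (s : ℝ) < d :=
          (NNReal.continuous_coe.tendsto t).eventually_lt_const htd
        filter_upwards [nhdsWithin_le_nhds this] with s hs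
        exact ((hmem s).2.1.trans_lt hs).trans hdc
      · have hpd : p t < S d := by
          by_contra h
          exact absurd (le_csSup (hbd t) ⟨(hmem t).1.trans hd.le, htd, not_lt.1 h⟩) (not_le.2 hd)
        filter_upwards [(hp_rc t).eventually_lt_const hpd] with s hs
        refine lt_of_le_of_lt ?_ hdc
        exact le_of_lt (hmono.reflect_lt ((hmem s).2.2.trans_lt hs))
  · refine le_antisymm (hmem t).2.2 ?_
    obtain ⟨a, ha, hSa⟩ := intermediate_value_Icc
      (by linarith [(show (0 : ℝ) ≤ t from t.2)] : (-1 : ℝ) ≤ t) hS.continuousOn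
      (show p t ∈ Icc (S (-1)) (S t) from ⟨by rw [hS0]; exact hp0 t, hpS t⟩)
    rw [← hSa]
    exact hmono (le_csSup (hbd t) ⟨ha.1, ha.2, hSa.le⟩)

/-- The decision rule `b_t + e^{κt} (X_{τ(t)} + μ₀)` that adds the bias `b` to the best estimate of
the state, when the signal is released according to the clock `τ`. -/
noncomputable def clockRule {Ω : Type*} (κ μ₀ : ℝ) (X : ℝ → Ω → ℝ) (b τ : ℝ≥0 → ℝ) (t : ℝ≥0)
    (ω : Ω) : ℝ :=
  b t + Real.exp (κ * t) * (X (τ t) ω + μ₀)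

theorem IsSignal.isDecisionRule_clockRule {Ω : Type*} [mΩ : MeasurableSpace Ω] {P : Measure Ω}
    {κ μ₀ : ℝ} {Y θ : ℝ≥0 → Ω → ℝ} {X : ℝ → Ω → ℝ}
    (hX : IsSignal P κ μ₀ Y θ X) {b τ : ℝ≥0 → ℝ} (hb : ∀ t, ContinuousWithinAt b (Ici t) t)
    (hτ : ∀ t, ContinuousWithinAt τ (Ici t) t) (hτt : ∀ t : ℝ≥0, τ t ≤ t) :
    IsDecisionRule Y θ (clockRule κ μ₀ X b τ) where
  adapted t := Measurable.const_add
    (Measurable.const_mul (Measurable.add_const (hX.adapted (τ t) t (hτt t)) _) _) _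
  rightContinuous ω t := by
    have h1 : ContinuousWithinAt (fun s ↦ X (τ s) ω) (Ici t) t :=
      (hX.continuous ω).continuousAt.comp_continuousWithinAt (hτ t)
    have h2 : Continuous fun s : ℝ≥0 ↦ Real.exp (κ * s) := by fun_prop
    exact (hb t).add (h2.continuousWithinAt.mul (h1.add continuousWithinAt_const))

theorem history_clockRule_le {Ω : Type*}
    {κ μ₀ : ℝ} {X : ℝ → Ω → ℝ} {b τ : ℝ≥0 → ℝ} (hτ : Monotone τ) (t : ℝ≥0) :
    history (clockRule κ μ₀ X b τ) t ≤ past X (τ t) :=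
  history_le fun _ hs ↦ Measurable.const_add (Measurable.const_mul (Measurable.add_const
    (measurable_past X (hτ hs)) _) _) _

theorem measurable_history_clockRule {Ω : Type*}
    {κ μ₀ : ℝ} {X : ℝ → Ω → ℝ} {b τ : ℝ≥0 → ℝ} (t : ℝ≥0) :
    Measurable[history (clockRule κ μ₀ X b τ) t] (X (τ t)) := by
  have e : X (τ t) = fun ω ↦ Real.exp (-(κ * t)) * (clockRule κ μ₀ X b τ t ω - b t) - μ₀ := by
    ext ω
    rw [clockRule, add_sub_cancel_left, ← mul_assoc, ← Real.exp_add]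
    simp
  rw [e]
  exact Measurable.sub_const (Measurable.const_mul (Measurable.sub_const
    (measurable_history _ le_rfl) _) _) _

theorem IsSignal.state_eq {Ω : Type*} [mΩ : MeasurableSpace Ω] {P : Measure Ω}
    {κ μ₀ : ℝ} {Y θ : ℝ≥0 → Ω → ℝ} {X : ℝ → Ω → ℝ} (hX : IsSignal P κ μ₀ Y θ X) (t : ℝ≥0)
    (ω : Ω) : θ t ω = Real.exp (κ * t) * (X t ω + μ₀) := by
  rw [hX.state, sub_add_cancel, ← mul_assoc, ← Real.exp_add]
  simp

theorem IsSignal.bias_postVar_clockRule {Ω : Type*} [mΩ : MeasurableSpace Ω] {P : Measure Ω}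
    [IsProbabilityMeasure P] {κ μ₀ : ℝ} {Y θ : ℝ≥0 → Ω → ℝ} {X : ℝ → Ω → ℝ}
    (hX : IsSignal P κ μ₀ Y θ X) {b τ : ℝ≥0 → ℝ} (hτ : Monotone τ) (hτt : ∀ t : ℝ≥0, τ t ≤ t)
    (t : ℝ≥0) :
    (∀ᵐ ω ∂P, bias P θ (clockRule κ μ₀ X b τ) t ω = b t) ∧
    ∀ᵐ ω ∂P, postVar P θ (clockRule κ μ₀ X b τ) t ω =
      Real.exp (κ * t) ^ 2 * (∫ ω, X t ω ^ 2 ∂P - ∫ ω, X (τ t) ω ^ 2 ∂P) := by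
  have hpast : past X (τ t) ≤ mΩ := iSup₂_le fun e _ ↦ (hX.measurable e).comap_le
  have hle : history (clockRule κ μ₀ X b τ) t ≤ mΩ :=
    (history_clockRule_le hτ t).trans hpast
  set E := Real.exp (κ * t)
  let err : Ω → ℝ := fun ω ↦ X t ω - X (τ t) ω
  have herr : Measurable err := (hX.measurable t).sub (hX.measurable _)
  have hind : Indep (MeasurableSpace.comap err inferInstance)
      (history (clockRule κ μ₀ X b τ) t) P :=
    (indep_of_indep_of_le_left (hX.indep (τ t) t (hτt t))
      (history_clockRule_le hτ t)).symm
  have hL : MemLp err 2 P := (hX.memLp t).sub (hX.memLp _)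
  have herr0 : ∫ ω, err ω ∂P = 0 := by
    simp only [err]
    rw [integral_sub ((hX.memLp t).integrable (by norm_num))
      ((hX.memLp _).integrable (by norm_num)), hX.mean, hX.mean, sub_zero]
  have c1 : P[err | history (clockRule κ μ₀ X b τ) t] =ᵐ[P] fun _ ↦ 0 := by
    have := condExp_indep_eq herr.comap_le hle
      (comap_measurable err).stronglyMeasurable hind
    rwa [herr0] at this
  have e1 : θ t = (fun ω ↦ E * (X (τ t) ω + μ₀)) + E • err := by
    ext ω
    rw [hX.state_eq t ω]
    simp only [Pi.add_apply, Pi.smul_apply, smul_eq_mul, err]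
    ring
  have hest : StronglyMeasurable[history (clockRule κ μ₀ X b τ) t]
      (fun ω ↦ E * (X (τ t) ω + μ₀)) :=
    (Measurable.const_mul (Measurable.add_const (measurable_history_clockRule t) _)
      _).stronglyMeasurable
  have iest : Integrable (fun ω ↦ E * (X (τ t) ω + μ₀)) P :=
    (((hX.memLp _).integrable (by norm_num)).add (integrable_const _)).const_mul _
  have c2 : P[θ t | history (clockRule κ μ₀ X b τ) t] =ᵐ[P] fun ω ↦ E * (X (τ t) ω + μ₀) := by
    rw [e1]
    refine (condExp_add iest ((hL.integrable (by norm_num)).smul E) _).trans ?_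
    rw [condExp_of_stronglyMeasurable hle hest iest]
    filter_upwards [c1, condExp_smul (μ := P) E err (history (clockRule κ μ₀ X b τ) t)] with ω h1 h2
    rw [Pi.add_apply, h2, Pi.smul_apply, h1]
    simp
  refine ⟨?_, ?_⟩
  · filter_upwards [c2] with ω h
    rw [bias, Pi.sub_apply, h, clockRule]
    ring
  · have e2 : (θ t - P[θ t | history (clockRule κ μ₀ X b τ) t]) ^ 2 =ᵐ[P]
        fun ω ↦ (E * err ω) ^ 2 := by
      filter_upwards [c2] with ω h
      simp only [Pi.pow_apply, Pi.sub_apply]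
      rw [h, e1]
      simp
    have hm2 : StronglyMeasurable[MeasurableSpace.comap err inferInstance]
        fun ω ↦ (E * err ω) ^ 2 :=
      (((comap_measurable err).const_mul E).pow_const 2).stronglyMeasurable
    have c3 := (condExp_congr_ae (m := history (clockRule κ μ₀ X b τ) t) e2).trans
      (condExp_indep_eq herr.comap_le hle hm2 hind)
    filter_upwards [c3] with ω h
    rw [postVar, condVar, h]
    simp_rw [mul_pow]
    rw [integral_const_mul, hX.integral_sub_sq (hτt t)]

/-- Whatever event the receiver has observed by time `s`, the conditional mean squared distance of
the action from the shifted state is the deterministic `(b_s - c)² + v_s`. -/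
theorem IsSignal.setLIntegral_clockRule {Ω : Type*} [mΩ : MeasurableSpace Ω] {P : Measure Ω}
    [IsProbabilityMeasure P] {κ μ₀ : ℝ} {Y θ : ℝ≥0 → Ω → ℝ} {X : ℝ → Ω → ℝ}
    (hX : IsSignal P κ μ₀ Y θ X) {b τ : ℝ≥0 → ℝ} (hτ : Monotone τ) (hτt : ∀ t : ℝ≥0, τ t ≤ t)
    (s : ℝ≥0) (c : ℝ) {G : Set Ω} (hG : MeasurableSet[history (clockRule κ μ₀ X b τ) s] G) :
    ∫⁻ ω in G, ENNReal.ofReal ((clockRule κ μ₀ X b τ s ω - θ s ω - c) ^ 2) ∂P =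
      ENNReal.ofReal ((b s - c) ^ 2 +
        Real.exp (κ * s) ^ 2 * (∫ ω, X s ω ^ 2 ∂P - ∫ ω, X (τ s) ω ^ 2 ∂P)) * P G := by
  have hpast : past X (τ s) ≤ mΩ := iSup₂_le fun e _ ↦ (hX.measurable e).comap_le
  set E := Real.exp (κ * s) with hE
  let err : Ω → ℝ := fun ω ↦ X s ω - X (τ s) ω
  have herr : Measurable err := (hX.measurable s).sub (hX.measurable _)
  have hL : MemLp err 2 P := (hX.memLp s).sub (hX.memLp _)
  have herr0 : ∫ ω, err ω ∂P = 0 := by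
    simp only [err]
    rw [integral_sub ((hX.memLp s).integrable (by norm_num))
      ((hX.memLp _).integrable (by norm_num)), hX.mean, hX.mean, sub_zero]
  have hG' : MeasurableSet[past X (τ s)] G := history_clockRule_le hτ s G hG
  have e1 : ∀ ω, clockRule κ μ₀ X b τ s ω - θ s ω - c = (b s - c) - E * err ω := fun ω ↦ by
    rw [hX.state_eq s ω, clockRule]
    simp only [err, ← hE]
    ring
  simp_rw [e1]
  rw [← lintegral_indicator (hpast G hG')]
  have e2 : (fun ω ↦ G.indicator (fun ω ↦ ENNReal.ofReal (((b s - c) - E * err ω) ^ 2)) ω) =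
      fun ω ↦ G.indicator (fun _ ↦ 1) ω * ENNReal.ofReal (((b s - c) - E * err ω) ^ 2) := by
    ext ω
    by_cases h : ω ∈ G <;> simp [h]
  rw [e2, lintegral_mul_eq_lintegral_mul_lintegral_of_independent_measurableSpace hpast
    herr.comap_le (hX.indep (τ s) s (hτt s)) (Measurable.indicator measurable_const hG')
    ((((comap_measurable err).const_mul E).const_sub (b s - c)).pow_const 2).ennreal_ofReal,
    lintegral_indicator (hpast G hG'), mul_comm]
  congr 1
  · have l1 : MemLp (fun ω ↦ (b s - c) - E * err ω) 2 P := (memLp_const _).sub (hL.const_mul E)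
    rw [← ofReal_integral_eq_lintegral_ofReal l1.integrable_sq
      (Filter.Eventually.of_forall fun ω ↦ sq_nonneg _)]
    congr 1
    have e3 : ∀ ω, ((b s - c) - E * err ω) ^ 2 =
        (b s - c) ^ 2 - 2 * (b s - c) * E * err ω + E ^ 2 * err ω ^ 2 := fun ω ↦ by ring
    simp_rw [e3]
    have i1 : Integrable (fun ω ↦ 2 * (b s - c) * E * err ω) P :=
      (hL.integrable (by norm_num)).const_mul _
    rw [integral_add (f := fun ω ↦ (b s - c) ^ 2 - 2 * (b s - c) * E * err ω)
      ((integrable_const _).sub i1) (hL.integrable_sq.const_mul _),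
      integral_sub (integrable_const _) i1, integral_const_mul, integral_const_mul, herr0,
      hX.integral_sub_sq (hτt s)]
    simp
  · simp

/-! ### Losses, utilities and the capped bias -/


/-- The mean squared distance `E (A_s - θ_s - c)²` at real time `s`, under a measure `Q` that may be
the restriction of the probability measure to an event. -/
noncomputable def meanLoss {Ω : Type*} [MeasurableSpace Ω] (Q : Measure Ω) (θ A : ℝ≥0 → Ω → ℝ)
    (c s : ℝ) : ℝ≥0∞ :=
  ∫⁻ ω, ENNReal.ofReal ((A s.toNNReal ω - θ s.toNNReal ω - c) ^ 2) ∂Q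

theorem measurable_sq_distance {Ω : Type*} [MeasurableSpace Ω] {θ A : ℝ≥0 → Ω → ℝ}
    (hA : Measurable fun q : ℝ≥0 × Ω ↦ A q.1 q.2) (hθ : Measurable fun q : ℝ≥0 × Ω ↦ θ q.1 q.2)
    (c : ℝ) :
    Measurable fun q : ℝ × Ω ↦
      ENNReal.ofReal ((A q.1.toNNReal q.2 - θ q.1.toNNReal q.2 - c) ^ 2) := by
  have h : Measurable fun q : ℝ × Ω ↦ (q.1.toNNReal, q.2) := by fun_prop
  exact ((((hA.comp h).sub (hθ.comp h)).sub_const c).pow_const 2).ennreal_ofReal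

theorem measurable_meanLoss {Ω : Type*} [MeasurableSpace Ω] {Q : Measure Ω} [SFinite Q]
    {θ A : ℝ≥0 → Ω → ℝ} (hA : Measurable fun q : ℝ≥0 × Ω ↦ A q.1 q.2)
    (hθ : Measurable fun q : ℝ≥0 × Ω ↦ θ q.1 q.2) (c : ℝ) : Measurable (meanLoss Q θ A c) :=
  (measurable_sq_distance hA hθ c).lintegral_prod_right'

theorem lintegral_discounted_sq_eq {Ω : Type*} [MeasurableSpace Ω] {Q : Measure Ω} [SFinite Q]
    {θ A : ℝ≥0 → Ω → ℝ} (hA : Measurable fun q : ℝ≥0 × Ω ↦ A q.1 q.2)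
    (hθ : Measurable fun q : ℝ≥0 × Ω ↦ θ q.1 q.2) {r : ℝ} (hr : 0 < r) (c : ℝ) {t : ℝ}
    (ht : 0 ≤ t) :
    ∫⁻ ω, (∫⁻ s in Ici t, ENNReal.ofReal (r * Real.exp (-r * (s - t)) *
        (A s.toNNReal ω - θ s.toNNReal ω - c) ^ 2)) ∂Q =
      ENNReal.ofReal (Real.exp (r * t)) * ∫⁻ s in Ici t, meanLoss Q θ A c s ∂(discount r) := by
  have hm := measurable_sq_distance hA hθ c
  have e : ∀ s ω, ENNReal.ofReal (r * Real.exp (-r * (s - t)) *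
      (A s.toNNReal ω - θ s.toNNReal ω - c) ^ 2) =
      ENNReal.ofReal (Real.exp (r * t)) * (ENNReal.ofReal (r * Real.exp (-r * s)) *
        ENNReal.ofReal ((A s.toNNReal ω - θ s.toNNReal ω - c) ^ 2)) := fun s ω ↦ by
    rw [← ENNReal.ofReal_mul (by positivity), ← ENNReal.ofReal_mul (by positivity)]
    congr 1
    rw [show -r * (s - t) = r * t + -r * s by ring, Real.exp_add]
    ring
  have hw : Measurable fun s : ℝ ↦ ENNReal.ofReal (r * Real.exp (-r * s)) := by fun_prop
  simp_rw [e]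
  rw [setLIntegral_discount r ht (measurable_meanLoss hA hθ c), lintegral_lintegral_swap]
  · rw [← lintegral_const_mul' _ _ ENNReal.ofReal_ne_top]
    refine lintegral_congr fun s ↦ ?_
    rw [lintegral_const_mul' _ _ ENNReal.ofReal_ne_top,
      lintegral_const_mul' _ _ ENNReal.ofReal_ne_top]
    rfl
  · refine Measurable.aemeasurable ?_
    exact (((hw.comp measurable_snd).mul (hm.comp measurable_swap))).const_mul _

theorem lintegral_continuationLoss {Ω : Type*} [MeasurableSpace Ω] {Q : Measure Ω} [SFinite Q]
    {θ A : ℝ≥0 → Ω → ℝ} (hA : Measurable fun q : ℝ≥0 × Ω ↦ A q.1 q.2)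
    (hθ : Measurable fun q : ℝ≥0 × Ω ↦ θ q.1 q.2) {r : ℝ} (hr : 0 < r) (t : ℝ≥0) :
    ∫⁻ ω, continuationLoss r θ A t ω ∂Q =
      ENNReal.ofReal (Real.exp (r * t)) *
        ∫⁻ s in Ici (t : ℝ), meanLoss Q θ A 0 s ∂(discount r) := by
  rw [← lintegral_discounted_sq_eq (t := (t : ℝ)) hA hθ hr 0 t.2]
  simp only [continuationLoss, sub_zero]

theorem utility_eq {Ω : Type*} [MeasurableSpace Ω] {P : Measure Ω} [SFinite P]
    {θ A : ℝ≥0 → Ω → ℝ} (hA : Measurable fun q : ℝ≥0 × Ω ↦ A q.1 q.2)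
    (hθ : Measurable fun q : ℝ≥0 × Ω ↦ θ q.1 q.2) {r : ℝ} (hr : 0 < r) (c : ℝ) :
    utility P r θ (senderFlow c) A =
      -((∫⁻ s in Ici (0 : ℝ), meanLoss P θ A c s ∂(discount r) : ℝ≥0∞) : EReal) := by
  have h := lintegral_discounted_sq_eq (Q := P) hA hθ hr c le_rfl
  simp only [sub_zero, mul_zero, Real.exp_zero, ENNReal.ofReal_one, one_mul] at h
  rw [utility, ← h]
  simp only [senderFlow, neg_neg]

theorem receiverFlow_eq : receiverFlow = senderFlow 0 := by
  ext a x
  simp [receiverFlow, senderFlow]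

theorem IsSignal.memLp_state {Ω : Type*} [mΩ : MeasurableSpace Ω] {P : Measure Ω}
    [IsProbabilityMeasure P] {κ μ₀ : ℝ} {Y θ : ℝ≥0 → Ω → ℝ} {X : ℝ → Ω → ℝ}
    (hX : IsSignal P κ μ₀ Y θ X) (t : ℝ≥0) : MemLp (θ t) 2 P := by
  have e : θ t = fun ω ↦ Real.exp (κ * t) * (X t ω + μ₀) := funext fun ω ↦ hX.state_eq t ω
  rw [e]
  exact ((hX.memLp t).add (memLp_const μ₀)).const_mul _

/-- The `L²` norm `√(D - v)` of the bias of a rule with mean squared loss `D` and mean conditional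
variance `v`, capped at the sender's ideal bias `β`. An infinite loss has infinite bias, hence the
value `β`. -/
noncomputable def cappedBias (β : ℝ) (D : ℝ≥0∞) (v : ℝ) : ℝ :=
  if D = ∞ then β else min β √(D.toReal - v)

theorem cappedBias_nonneg {β : ℝ} (hβ : 0 ≤ β) (D : ℝ≥0∞) (v : ℝ) : 0 ≤ cappedBias β D v := by
  unfold cappedBias
  split_ifs
  · exact hβ
  · exact le_min hβ (Real.sqrt_nonneg _)

theorem cappedBias_le (β : ℝ) (D : ℝ≥0∞) (v : ℝ) : cappedBias β D v ≤ β := by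
  unfold cappedBias
  split_ifs
  · exact le_rfl
  · exact min_le_left _ _

/-- Replacing the random bias of the prediction `a` of `f` by the constant `cappedBias` raises
neither the loss relative to `f` nor the loss relative to `f + β`. -/
theorem cappedBias_loss_le {Ω : Type*} {m mΩ : MeasurableSpace Ω} {P : Measure Ω}
    [IsProbabilityMeasure P] (hm : m ≤ mΩ) {f a : Ω → ℝ} (hf : MemLp f 2 P)
    (ha : Measurable[m] a) {β : ℝ} (hβ : 0 ≤ β) :
    ENNReal.ofReal (cappedBias β (∫⁻ ω, ENNReal.ofReal ((a ω - f ω) ^ 2) ∂P)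
        (∫ ω, (f ω - (P[f | m]) ω) ^ 2 ∂P) ^ 2 + ∫ ω, (f ω - (P[f | m]) ω) ^ 2 ∂P) ≤
      ∫⁻ ω, ENNReal.ofReal ((a ω - f ω) ^ 2) ∂P ∧
    ENNReal.ofReal ((cappedBias β (∫⁻ ω, ENNReal.ofReal ((a ω - f ω) ^ 2) ∂P)
        (∫ ω, (f ω - (P[f | m]) ω) ^ 2 ∂P) - β) ^ 2 + ∫ ω, (f ω - (P[f | m]) ω) ^ 2 ∂P) ≤
      ∫⁻ ω, ENNReal.ofReal ((a ω - f ω - β) ^ 2) ∂P := by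
  set v := ∫ ω, (f ω - (P[f | m]) ω) ^ 2 ∂P with hv
  set D := ∫⁻ ω, ENNReal.ofReal ((a ω - f ω) ^ 2) ∂P with hD
  have ham : Measurable a := ha.mono hm le_rfl
  by_cases hDtop : D = ∞
  · have h2 : ∫⁻ ω, ENNReal.ofReal ((a ω - f ω - β) ^ 2) ∂P = ∞ := by
      by_contra h
      have hle : D ≤ ∫⁻ ω, (2 * ENNReal.ofReal ((a ω - f ω - β) ^ 2) +
          ENNReal.ofReal (2 * β ^ 2)) ∂P := by
        refine lintegral_mono fun ω ↦ ?_
        rw [show (2 : ℝ≥0∞) = ENNReal.ofReal 2 by simp, ← ENNReal.ofReal_mul (by norm_num),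
          ← ENNReal.ofReal_add (by positivity) (by positivity)]
        exact ENNReal.ofReal_le_ofReal (by nlinarith [sq_nonneg (a ω - f ω - β - β)])
      rw [lintegral_add_right _ measurable_const, lintegral_const_mul' _ _ (by simp)] at hle
      simp only [lintegral_const, measure_univ, mul_one, hDtop, top_le_iff] at hle
      exact (ENNReal.add_ne_top.2 ⟨ENNReal.mul_ne_top (by simp) h, ENNReal.ofReal_ne_top⟩) hle
    rw [h2, hDtop]
    exact ⟨le_top, le_top⟩
  · have hmeas : AEStronglyMeasurable (fun ω ↦ a ω - f ω) P :=
      ham.aestronglyMeasurable.sub hf.aestronglyMeasurable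
    have hint : Integrable (fun ω ↦ (a ω - f ω) ^ 2) P := by
      refine ⟨hmeas.pow 2, ?_⟩
      rw [hasFiniteIntegral_iff_ofReal (Filter.Eventually.of_forall fun ω ↦ sq_nonneg _)]
      exact lt_top_iff_ne_top.2 hDtop
    have hdL : MemLp (fun ω ↦ a ω - f ω) 2 P := (memLp_two_iff_integrable_sq hmeas).2 hint
    have haL : MemLp a 2 P := by
      have := hdL.add hf
      refine this.ae_eq (Filter.Eventually.of_forall fun ω ↦ ?_)
      simp
    set B : Ω → ℝ := fun ω ↦ a ω - (P[f | m]) ω with hB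
    have hBL : MemLp B 2 P := haL.sub (hf.condExp (by norm_num))
    have pyth : ∀ c, ∫ ω, (a ω - f ω - c) ^ 2 ∂P = ∫ ω, (B ω - c) ^ 2 ∂P + v := fun c ↦ by
      have := integral_sub_sq_eq_add hm hf (h := fun ω ↦ a ω - c) (haL.sub (memLp_const c))
        (ha.sub_const c).stronglyMeasurable
      simpa only [sub_right_comm _ c] using this
    have toL : ∀ c, ∫⁻ ω, ENNReal.ofReal ((a ω - f ω - c) ^ 2) ∂P =
        ENNReal.ofReal (∫ ω, (a ω - f ω - c) ^ 2 ∂P) := fun c ↦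
      (ofReal_integral_eq_lintegral_ofReal (hdL.sub (memLp_const c)).integrable_sq
        (Filter.Eventually.of_forall fun ω ↦ sq_nonneg _)).symm
    have v0 : 0 ≤ v := integral_nonneg fun ω ↦ sq_nonneg _
    set N := ∫ ω, B ω ^ 2 ∂P with hN
    have N0 : 0 ≤ N := integral_nonneg fun ω ↦ sq_nonneg _
    have hDN : D = ENNReal.ofReal (N + v) := by
      have h1 := toL 0
      have h2 := pyth 0
      simp only [sub_zero] at h1 h2
      rw [hD, h1, h2]
    have hg : cappedBias β D v = min β √N := by
      rw [cappedBias, if_neg hDtop, hDN, ENNReal.toReal_ofReal (by linarith), add_sub_cancel_right]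
    have hmean : (∫ ω, B ω ∂P) ^ 2 ≤ N := by
      have h := variance_nonneg B P
      rw [variance_eq_sub hBL] at h
      simp only [Pi.pow_apply] at h
      linarith
    have hmean' : ∫ ω, B ω ∂P ≤ √N := Real.le_sqrt_of_sq_le hmean
    have hexp : ∫ ω, (B ω - β) ^ 2 ∂P = N - 2 * β * ∫ ω, B ω ∂P + β ^ 2 := by
      have e : ∀ ω, (B ω - β) ^ 2 = B ω ^ 2 - 2 * β * B ω + β ^ 2 := fun ω ↦ by ring
      simp_rw [e]
      have i1 : Integrable (fun ω ↦ 2 * β * B ω) P := (hBL.integrable (by norm_num)).const_mul _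
      rw [integral_add (f := fun ω ↦ B ω ^ 2 - 2 * β * B ω) (hBL.integrable_sq.sub i1)
        (integrable_const _), integral_sub hBL.integrable_sq i1, integral_const_mul]
      simp [hN]
    have hs := Real.sq_sqrt N0
    have s0 := Real.sqrt_nonneg N
    refine ⟨?_, ?_⟩
    · rw [hg, hDN]
      refine ENNReal.ofReal_le_ofReal ?_
      have : min β √N ^ 2 ≤ √N ^ 2 := pow_le_pow_left₀ (le_min hβ s0) (min_le_right _ _) 2
      linarith
    · rw [hg, toL, pyth, hexp]
      refine ENNReal.ofReal_le_ofReal ?_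
      have h1 : (min β √N - β) ^ 2 ≤ (√N - β) ^ 2 := by
        rcases le_total β √N with h | h
        · rw [min_eq_left h, sub_self]; nlinarith [sq_nonneg (√N - β)]
        · rw [min_eq_right h]
      nlinarith [mul_le_mul_of_nonneg_left hmean' hβ]

/-! ### Information released by a decision rule -/


/-- The expected conditional variance of the signal `X t` given the history of `A` up to time `t`;
for `t ≥ 0` the signal is the centered discounted state. -/
noncomputable def residualVar {Ω : Type*} [MeasurableSpace Ω] (P : Measure Ω) (X : ℝ → Ω → ℝ)
    (A : ℝ≥0 → Ω → ℝ) (t : ℝ≥0) : ℝ :=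
  ∫ ω, (X t ω - (P[X t | history A t]) ω) ^ 2 ∂P

theorem residualVar_nonneg {Ω : Type*} [MeasurableSpace Ω] (P : Measure Ω) (X : ℝ → Ω → ℝ)
    (A : ℝ≥0 → Ω → ℝ) (t : ℝ≥0) : 0 ≤ residualVar P X A t :=
  integral_nonneg fun _ ↦ sq_nonneg _

theorem IsSignal.residualVar_le {Ω : Type*} [mΩ : MeasurableSpace Ω] {P : Measure Ω}
    [IsProbabilityMeasure P] {κ μ₀ : ℝ} {Y θ : ℝ≥0 → Ω → ℝ} {X : ℝ → Ω → ℝ}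
    (hX : IsSignal P κ μ₀ Y θ X) {A : ℝ≥0 → Ω → ℝ} {t : ℝ≥0} (hm : history A t ≤ mΩ) :
    residualVar P X A t ≤ ∫ ω, X t ω ^ 2 ∂P := by
  have h := integral_sub_sq_eq_add hm (hX.memLp t) (h := fun _ ↦ 0) (memLp_const 0)
    stronglyMeasurable_const
  have : 0 ≤ ∫ ω, (0 - (P[X t | history A t]) ω) ^ 2 ∂P := integral_nonneg fun ω ↦ sq_nonneg _
  simp only [zero_sub, neg_sq] at h this
  rw [residualVar]
  linarith

theorem history_le_senderInfo {Ω : Type*} {Y θ A : ℝ≥0 → Ω → ℝ} (hA : IsDecisionRule Y θ A)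
    (t : ℝ≥0) : history A t ≤ senderInfo Y θ t :=
  history_le fun s hs ↦ (hA.adapted s).mono (senderInfo_mono Y θ hs) le_rfl

/-- The amount of information released by a decision rule is nondecreasing in time: yesterday's
estimate is still available today, and the innovation in between is unpredictable for the sender. -/
theorem IsSignal.monotone_information {Ω : Type*} [mΩ : MeasurableSpace Ω] {P : Measure Ω}
    [IsProbabilityMeasure P] {κ μ₀ : ℝ} {Y θ : ℝ≥0 → Ω → ℝ} {X : ℝ → Ω → ℝ}
    (hX : IsSignal P κ μ₀ Y θ X) (hle : ∀ t, senderInfo Y θ t ≤ mΩ) {A : ℝ≥0 → Ω → ℝ}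
    (hA : IsDecisionRule Y θ A) :
    Monotone fun t : ℝ≥0 ↦ ∫ ω, X t ω ^ 2 ∂P - residualVar P X A t := by
  intro s t hst
  have hmt : history A t ≤ mΩ := (history_le_senderInfo hA t).trans (hle t)
  have hst' : (s : ℝ) ≤ t := NNReal.coe_le_coe.2 hst
  set e : Ω → ℝ := P[X s | history A s] with he
  have heL : MemLp e 2 P := (hX.memLp s).condExp (by norm_num)
  have hes : StronglyMeasurable[history A s] e := stronglyMeasurable_condExp
  have h1 := integral_sub_sq_eq_add hmt (hX.memLp t) heL (hes.mono (history_mono A hst))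
  have hd : MemLp (fun ω ↦ X t ω - X s ω) 2 P := (hX.memLp t).sub (hX.memLp s)
  have hes' : MemLp (fun ω ↦ e ω - X s ω) 2 P := heL.sub (hX.memLp s)
  have hind : IndepFun (fun ω ↦ e ω - X s ω) (fun ω ↦ X t ω - X s ω) P := by
    rw [IndepFun_iff_Indep]
    refine indep_of_indep_of_le_left (hX.indep_senderInfo s t hst) (Measurable.comap_le ?_)
    exact Measurable.sub (hes.measurable.mono (history_le_senderInfo hA s) le_rfl)
      (hX.adapted s s le_rfl)
  have h0 : ∫ ω, (e ω - X s ω) * (X t ω - X s ω) ∂P = 0 := by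
    rw [hind.integral_fun_mul_eq_mul_integral hes'.aestronglyMeasurable hd.aestronglyMeasurable,
      integral_sub ((hX.memLp t).integrable (by norm_num)) ((hX.memLp s).integrable (by norm_num)),
      hX.mean, hX.mean]
    simp
  have h2 : ∫ ω, (e ω - X t ω) ^ 2 ∂P =
      residualVar P X A s + (∫ ω, X t ω ^ 2 ∂P - ∫ ω, X s ω ^ 2 ∂P) := by
    have ex : ∀ ω, (e ω - X t ω) ^ 2 = (X s ω - e ω) ^ 2 + (X t ω - X s ω) ^ 2 -
        2 * ((e ω - X s ω) * (X t ω - X s ω)) := fun ω ↦ by ring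
    have i1 : Integrable (fun ω ↦ (X s ω - e ω) ^ 2) P := ((hX.memLp s).sub heL).integrable_sq
    have i2 : Integrable (fun ω ↦ 2 * ((e ω - X s ω) * (X t ω - X s ω))) P :=
      (hes'.integrable_mul hd).const_mul 2
    simp_rw [ex]
    rw [integral_sub (f := fun ω ↦ (X s ω - e ω) ^ 2 + (X t ω - X s ω) ^ 2)
      (i1.add hd.integrable_sq) i2, integral_add i1 hd.integrable_sq, integral_const_mul, h0,
      hX.integral_sub_sq hst', residualVar]
    ring
  have h3 : 0 ≤ ∫ ω, (e ω - (P[X t | history A t]) ω) ^ 2 ∂P :=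
    integral_nonneg fun ω ↦ sq_nonneg _
  have h4 : residualVar P X A t = ∫ ω, (X t ω - (P[X t | history A t]) ω) ^ 2 ∂P := rfl
  simp only
  linarith

theorem IsSignal.integral_state_sub_sq {Ω : Type*} [mΩ : MeasurableSpace Ω] {P : Measure Ω}
    [IsProbabilityMeasure P] {κ μ₀ : ℝ} {Y θ : ℝ≥0 → Ω → ℝ} {X : ℝ → Ω → ℝ}
    (hX : IsSignal P κ μ₀ Y θ X) {A : ℝ≥0 → Ω → ℝ} {t : ℝ≥0} (hm : history A t ≤ mΩ) :
    ∫ ω, (θ t ω - (P[θ t | history A t]) ω) ^ 2 ∂P =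
      Real.exp (κ * t) ^ 2 * residualVar P X A t := by
  have e1 : θ t = Real.exp (κ * t) • X t + fun _ ↦ Real.exp (κ * t) * μ₀ := by
    ext ω
    rw [hX.state_eq t ω]
    simp only [Pi.add_apply, Pi.smul_apply, smul_eq_mul]
    ring
  have c : P[θ t | history A t] =ᵐ[P]
      fun ω ↦ Real.exp (κ * t) * (P[X t | history A t]) ω + Real.exp (κ * t) * μ₀ := by
    rw [e1]
    refine (condExp_add (((hX.memLp t).integrable (by norm_num)).smul _)
      (integrable_const _) _).trans ?_
    rw [condExp_const hm]
    filter_upwards [condExp_smul (μ := P) (Real.exp (κ * t)) (X t) (history A t)] with ω h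
    rw [Pi.add_apply, h]
    rfl
  rw [residualVar, ← integral_const_mul]
  refine integral_congr_ae ?_
  filter_upwards [c] with ω h
  rw [h, hX.state_eq t ω]
  ring

/-- Taking expectations in the obedience constraint at time `t`. -/
theorem IsSignal.lintegral_meanLoss_le_of_isObedient {Ω : Type*} [mΩ : MeasurableSpace Ω]
    {P : Measure Ω} [IsProbabilityMeasure P] {κ σ r μ₀ : ℝ} {Y θ : ℝ≥0 → Ω → ℝ} {X : ℝ → Ω → ℝ}
    (hX : IsSignal P κ μ₀ Y θ X) (hr : 0 < r) (hκ : 2 * κ < r) {A : ℝ≥0 → Ω → ℝ}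
    (hAm : Measurable fun q : ℝ≥0 × Ω ↦ A q.1 q.2)
    (hθm : Measurable fun q : ℝ≥0 × Ω ↦ θ q.1 q.2)
    (hobed : IsObedient P κ σ r θ A) {t : ℝ≥0} (hm : history A t ≤ mΩ) :
    ENNReal.ofReal (Real.exp (r * t)) *
        ∫⁻ s in Ici (t : ℝ), meanLoss P θ A 0 s ∂(discount r) ≤
      ENNReal.ofReal ((σ ^ 2 + r * (Real.exp (κ * t) ^ 2 * residualVar P X A t)) /
        (r - 2 * κ)) := by
  have hint : ∫ ω, postVar P θ A t ω ∂P = Real.exp (κ * t) ^ 2 * residualVar P X A t := by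
    rw [← hX.integral_state_sub_sq hm, postVar, condVar, integral_condExp hm]
    rfl
  have hnn : 0 ≤ᵐ[P] postVar P θ A t :=
    condExp_nonneg (Filter.Eventually.of_forall fun ω ↦ by
      simpa using sq_nonneg _)
  have hpi : Integrable (postVar P θ A t) P := integrable_condVar
  rw [← lintegral_continuationLoss hAm hθm hr t, ← lintegral_condLExp hm]
  refine (lintegral_mono_ae (hobed t)).trans (le_of_eq ?_)
  have hden : 0 < r - 2 * κ := by linarith
  rw [← hint, ← ofReal_integral_eq_lintegral_ofReal
    (f := fun ω ↦ (σ ^ 2 + r * postVar P θ A t ω) / (r - 2 * κ)) (((integrable_const _).add (hpi.const_mul r)).div_const _)]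
  · congr 1
    rw [integral_div, integral_add (integrable_const _) (hpi.const_mul r), integral_const_mul]
    simp
  · filter_upwards [hnn] with ω h
    have h : 0 ≤ postVar P θ A t ω := h
    simp only [Pi.zero_apply]
    positivity

theorem continuousWithinAt_rightLim {p : ℝ≥0 → ℝ} (hp : Monotone p) (t : ℝ≥0) :
    ContinuousWithinAt (Function.rightLim p) (Ici t) t := by
  refine tendsto_order.2 ⟨fun c hc ↦ ?_, fun c hc ↦ ?_⟩
  · filter_upwards [self_mem_nhdsWithin] with s hs
    exact hc.trans_le (hp.rightLim hs)
  · have h1 := (hp.tendsto_rightLim t).eventually_lt_const hc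
    obtain ⟨s, hs, hts⟩ := (h1.and self_mem_nhdsWithin).exists
    filter_upwards [nhdsWithin_le_nhds (Iio_mem_nhds (show t < s from hts))] with u hu
    exact (hp.rightLim_le hu).trans_lt hs

theorem rightLim_le_of_le {p S : ℝ≥0 → ℝ} (hp : Monotone p) (hS : Continuous S)
    (h : ∀ t, p t ≤ S t) (t : ℝ≥0) : Function.rightLim p t ≤ S t :=
  le_of_tendsto_of_tendsto (hp.tendsto_rightLim t) (hS.continuousWithinAt (s := Ioi t) (x := t))
    (Filter.Eventually.of_forall h)

theorem tendsto_nhdsGT_add_one_div (t : ℝ≥0) :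
    Filter.Tendsto (fun n : ℕ ↦ t + 1 / ((n : ℝ≥0) + 1)) Filter.atTop (nhdsWithin t (Ioi t)) := by
  refine tendsto_nhdsWithin_iff.2 ⟨?_, Filter.Eventually.of_forall fun n ↦ ?_⟩
  · simpa using (tendsto_one_div_add_atTop_nhds_zero_nat (𝕜 := ℝ≥0)).const_add t
  · exact lt_add_of_pos_right t (by positivity)

/-- A bound on the tails of an integral passes to right limits of the bound. -/
theorem setLIntegral_Ici_le_of_tendsto {r : ℝ} {f : ℝ → ℝ≥0∞} {G : ℝ≥0 → ℝ≥0∞}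
    {t : ℝ≥0} {L : ℝ≥0∞}
    (h : ∀ s : ℝ≥0, ∫⁻ x in Ici (s : ℝ), f x ∂(discount r) ≤ G s)
    (hG : Filter.Tendsto G (nhdsWithin t (Ioi t)) (nhds L)) :
    ∫⁻ x in Ici (t : ℝ), f x ∂(discount r) ≤ L := by
  have hnull : discount r {(t : ℝ)} = 0 :=
    (withDensity_absolutelyContinuous _ _).trans Measure.restrict_le_self.absolutelyContinuous
      (Real.volume_singleton)
  have hae : Ici (t : ℝ) =ᵐ[discount r] Ioi (t : ℝ) := (Ioi_ae_eq_Ici' hnull).symm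
  rw [Measure.restrict_congr_set hae]
  set u : ℕ → ℝ≥0 := fun n ↦ t + 1 / ((n : ℝ≥0) + 1) with hu
  have hU : Ioi (t : ℝ) = ⋃ n, Ici (u n : ℝ) := by
    ext x
    simp only [mem_Ioi, mem_iUnion, mem_Ici, hu]
    push_cast
    constructor
    · intro hx
      obtain ⟨n, hn⟩ := exists_nat_one_div_lt (sub_pos.2 hx)
      exact ⟨n, by linarith⟩
    · rintro ⟨n, hn⟩
      have : 0 < 1 / ((n : ℝ) + 1) := by positivity
      linarith
  have hmono : Monotone fun n ↦ Ici (u n : ℝ) := fun n k hnk ↦ Ici_subset_Ici.2 (by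
    simp only [hu]
    push_cast
    have : 1 / ((k : ℝ) + 1) ≤ 1 / ((n : ℝ) + 1) :=
      one_div_le_one_div_of_le (by positivity) (by exact_mod_cast Nat.succ_le_succ hnk)
    linarith)
  rw [hU, setLIntegral_iUnion_of_directed _ (directed_of_isDirected_le hmono)]
  have hlim := hG.comp (tendsto_nhdsGT_add_one_div t)
  refine iSup_le fun n ↦ ge_of_tendsto hlim ?_
  filter_upwards [Filter.eventually_ge_atTop n] with k hk
  exact (lintegral_mono_set (hmono hk)).trans (h (u k))

/-! ### The rule with deterministic bias and variance -/


/-- A clock rule is obedient as soon as its deterministic bias and variance satisfy the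
deterministic obedience constraint. -/
theorem IsSignal.isObedient_clockRule {Ω : Type*} [mΩ : MeasurableSpace Ω] {P : Measure Ω}
    [IsProbabilityMeasure P] {κ σ r μ₀ : ℝ} {Y θ : ℝ≥0 → Ω → ℝ} {X : ℝ → Ω → ℝ}
    (hX : IsSignal P κ μ₀ Y θ X) (hr : 0 < r) {b τ v : ℝ≥0 → ℝ} (hτ : Monotone τ)
    (hτt : ∀ t : ℝ≥0, τ t ≤ t)
    (hv : ∀ t : ℝ≥0, v t =
      Real.exp (κ * t) ^ 2 * (∫ ω, X t ω ^ 2 ∂P - ∫ ω, X (τ t) ω ^ 2 ∂P))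
    (hAm : Measurable fun q : ℝ≥0 × Ω ↦ clockRule κ μ₀ X b τ q.1 q.2)
    (hθm : Measurable fun q : ℝ≥0 × Ω ↦ θ q.1 q.2)
    (hobed : ∀ t : ℝ≥0, ENNReal.ofReal (Real.exp (r * t)) * ∫⁻ s in Ici (t : ℝ),
      ENNReal.ofReal (b s.toNNReal ^ 2 + v s.toNNReal) ∂(discount r) ≤
        ENNReal.ofReal ((σ ^ 2 + r * v t) / (r - 2 * κ))) :
    IsObedient P κ σ r θ (clockRule κ μ₀ X b τ) := by
  intro t
  have hm : ∀ s, history (clockRule κ μ₀ X b τ) s ≤ mΩ := fun s ↦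
    (history_clockRule_le hτ s).trans (iSup₂_le fun e _ ↦ (hX.measurable e).comap_le)
  have key : (fun _ ↦ ENNReal.ofReal (Real.exp (r * t)) * ∫⁻ s in Ici (t : ℝ),
        ENNReal.ofReal (b s.toNNReal ^ 2 + v s.toNNReal) ∂(discount r)) =ᵐ[P]
      condLExp (history (clockRule κ μ₀ X b τ) t) P
        (continuationLoss r θ (clockRule κ μ₀ X b τ) t) := by
    refine ae_eq_condLExp (hm t) P _ measurable_const fun G hG ↦ ?_
    rw [lintegral_continuationLoss hAm hθm hr, lintegral_const, mul_assoc,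
      ← lintegral_mul_const' _ _ (measure_ne_top _ _)]
    congr 1
    refine setLIntegral_congr_fun measurableSet_Ici fun s hs ↦ ?_
    have hts : t ≤ s.toNNReal := NNReal.le_toNNReal_of_coe_le hs
    have h := hX.setLIntegral_clockRule (b := b) hτ hτt s.toNNReal 0
      (history_mono _ hts G hG)
    rw [← hv, sub_zero] at h
    rw [meanLoss, h, Measure.restrict_apply_univ]
  filter_upwards [key, (hX.bias_postVar_clockRule (b := b) hτ hτt t).2] with ω h1 h2
  rw [← h1, h2, ← hv]
  exact hobed t

theorem IsSignal.meanLoss_clockRule {Ω : Type*} [mΩ : MeasurableSpace Ω] {P : Measure Ω}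
    [IsProbabilityMeasure P] {κ μ₀ : ℝ} {Y θ : ℝ≥0 → Ω → ℝ} {X : ℝ → Ω → ℝ}
    (hX : IsSignal P κ μ₀ Y θ X) {b τ : ℝ≥0 → ℝ} (hτ : Monotone τ)
    (hτt : ∀ t : ℝ≥0, τ t ≤ t) (c s : ℝ) :
    meanLoss P θ (clockRule κ μ₀ X b τ) c s = ENNReal.ofReal ((b s.toNNReal - c) ^ 2 +
      Real.exp (κ * s.toNNReal) ^ 2 *
        (∫ ω, X s.toNNReal ω ^ 2 ∂P - ∫ ω, X (τ s.toNNReal) ω ^ 2 ∂P)) := by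
  have h := hX.setLIntegral_clockRule (b := b) hτ hτt s.toNNReal c MeasurableSet.univ
  rwa [setLIntegral_univ, measure_univ, mul_one] at h

end BiasVariance

theorem proposition2 {Ω : Type*} [MeasurableSpace Ω] (P : Measure Ω) [IsProbabilityMeasure P]
    (β κ σ r μ₀ : ℝ) (σ₀ : ℝ≥0) (hβ : 0 < β) (hσ : 0 < σ) (hr : 0 < r) (hκ : 2 * κ < r)
    (Z Y θ : ℝ≥0 → Ω → ℝ) (hE : BiasVariance.IsEnvironment P κ σ μ₀ σ₀ Z Y θ)
    (A : ℝ≥0 → Ω → ℝ) (hA : BiasVariance.IsDecisionRule Y θ A)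
    (hobed : BiasVariance.IsObedient P κ σ r θ A) :
    ∃ A' : ℝ≥0 → Ω → ℝ,
      BiasVariance.IsDecisionRule Y θ A' ∧
      BiasVariance.IsObedient P κ σ r θ A' ∧
      BiasVariance.HasDeterministicBiasVariance P θ A' ∧
      BiasVariance.utility P r θ (BiasVariance.senderFlow β) A ≤
        BiasVariance.utility P r θ (BiasVariance.senderFlow β) A' ∧
      BiasVariance.utility P r θ BiasVariance.receiverFlow A ≤
        BiasVariance.utility P r θ BiasVariance.receiverFlow A' := by
  open BiasVariance in
  have hX := hE.isSignal_signal hσ.ne'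
  set X := signal κ μ₀ σ₀ Y θ
  have hm : ∀ t, history A t ≤ _ := fun t ↦ (history_le_senderInfo hA t).trans (hE.senderInfo_le t)
  have rule_meas : ∀ {A : ℝ≥0 → Ω → ℝ}, IsDecisionRule Y θ A →
      Measurable fun q : ℝ≥0 × Ω ↦ A q.1 q.2 := fun h ↦
    measurable_uncurry_of_rightContinuous
      (fun t ↦ (h.adapted t).mono (hE.senderInfo_le t) le_rfl) h.rightContinuous
  have hAm := rule_meas hA
  have hθm : Measurable fun q : ℝ≥0 × Ω ↦ θ q.1 q.2 :=
    measurable_uncurry_of_rightContinuous hE.measurable_θ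
      fun ω t ↦ (hE.continuous_θ ω).continuousWithinAt
  -- The information released by `A`, and its right-continuous version `p'`.
  let S : ℝ → ℝ := fun a ↦ ∫ ω, X a ω ^ 2 ∂P
  have hSc : Continuous S := hX.continuous_integral_sq
  have hSc' : Continuous fun t : ℝ≥0 ↦ S t := hSc.comp NNReal.continuous_coe
  have hS0 : S (-1) = 0 := by
    refine integral_eq_zero_of_ae ?_
    filter_upwards [hX.start] with ω h
    simp [h]
  let p : ℝ≥0 → ℝ := fun t ↦ S t - residualVar P X A t
  have hp : Monotone p := hX.monotone_information hE.senderInfo_le hA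
  have hp0 : ∀ t, 0 ≤ p t := fun t ↦ sub_nonneg.2 (hX.residualVar_le (hm t))
  have hpS : ∀ t : ℝ≥0, p t ≤ S t := fun t ↦
    sub_le_self _ (residualVar_nonneg P X A t)
  let p' : ℝ≥0 → ℝ := Function.rightLim p
  have hpp' : ∀ t, p t ≤ p' t := fun t ↦ hp.le_rightLim le_rfl
  have hp'S : ∀ t : ℝ≥0, p' t ≤ S t := rightLim_le_of_le hp hSc' hpS
  obtain ⟨τ, hτ, hτc, hτt, hSτ⟩ := exists_clock hSc hX.monotone_integral_sq hS0 hp.rightLim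
    (continuousWithinAt_rightLim hp) (fun t ↦ (hp0 t).trans (hpp' t)) hp'S
  let v : ℝ≥0 → ℝ := fun t ↦ Real.exp (κ * t) ^ 2 * residualVar P X A t
  let v' : ℝ≥0 → ℝ := fun t ↦ Real.exp (κ * t) ^ 2 * (S t - p' t)
  have hvp : ∀ t, v t = Real.exp (κ * t) ^ 2 * (S t - p t) := fun t ↦ by simp [v, p]
  have hv0 : ∀ t, 0 ≤ v t := fun t ↦ mul_nonneg (by positivity) (residualVar_nonneg P X A t)
  have hv'v : ∀ t, v' t ≤ v t := fun t ↦ by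
    rw [hvp]
    exact mul_le_mul_of_nonneg_left (by linarith [hpp' t]) (by positivity)
  have hvm : Measurable v := by
    have h1 := hp.measurable
    have h2 := hSc'.measurable
    rw [show v = fun t : ℝ≥0 ↦ Real.exp (κ * t) ^ 2 * (S t - p t) from funext hvp]
    fun_prop
  -- The deterministic bias: capped norm of the bias of `A`, decreasingly rearranged.
  let g : ℝ → ℝ := fun s ↦ cappedBias β (meanLoss P θ A 0 s) (v s.toNNReal)
  have hDm : ∀ c, Measurable (meanLoss P θ A c) := fun c ↦ measurable_meanLoss hAm hθm c
  have hgm : Measurable g := by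
    have h1 := hDm 0
    refine Measurable.ite (h1 (measurableSet_singleton ∞)) measurable_const ?_
    fun_prop
  have hg1 : ∀ s, ENNReal.ofReal (g s ^ 2 + v s.toNNReal) ≤ meanLoss P θ A 0 s := fun s ↦ by
    have h := (cappedBias_loss_le (hm s.toNNReal) (hX.memLp_state s.toNNReal)
      (measurable_history A le_rfl) hβ.le).1
    rw [hX.integral_state_sub_sq (hm _)] at h
    simpa only [g, meanLoss, sub_zero] using h
  have hg2 : ∀ s, ENNReal.ofReal ((g s - β) ^ 2 + v s.toNNReal) ≤ meanLoss P θ A β s := fun s ↦ by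
    have h := (cappedBias_loss_le (hm s.toNNReal) (hX.memLp_state s.toNNReal)
      (measurable_history A le_rfl) hβ.le).2
    rw [hX.integral_state_sub_sq (hm _)] at h
    simpa only [g, meanLoss, sub_zero] using h
  obtain ⟨b, hbm, -, -, hbc, hblaw, hbtail⟩ := exists_decreasing_rearrangement hr hβ.le hgm
    (fun s ↦ cappedBias_nonneg hβ.le _ _) (fun s ↦ cappedBias_le β _ _)
  have hbc' : ∀ t : ℝ≥0, ContinuousWithinAt (fun s : ℝ≥0 ↦ b s) (Ici t) t := fun t ↦
    (hbc t t.2).comp NNReal.continuous_coe.continuousWithinAt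
      fun s hs ↦ NNReal.coe_le_coe.2 hs
  have hrule : IsDecisionRule Y θ (clockRule κ μ₀ X (fun s : ℝ≥0 ↦ b s) τ) :=
    hX.isDecisionRule_clockRule hbc' hτc hτt
  have hA'm := rule_meas hrule
  have hv'eq : ∀ t : ℝ≥0, v' t =
      Real.exp (κ * t) ^ 2 * (∫ ω, X t ω ^ 2 ∂P - ∫ ω, X (τ t) ω ^ 2 ∂P) := fun t ↦ by
    have : ∫ ω, X (τ t) ω ^ 2 ∂P = p' t := hSτ t
    rw [this]
  have hvmR : Measurable fun s : ℝ ↦ ENNReal.ofReal (v s.toNNReal) := by fun_prop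
  -- Splitting the loss into bias and variance, and comparing with `A`.
  have split : ∀ (f : ℝ → ℝ) (c : ℝ) (t : ℝ), Measurable f →
      ∫⁻ s in Ici t, ENNReal.ofReal ((f s - c) ^ 2 + v s.toNNReal) ∂(discount r) =
        ∫⁻ s in Ici t, ENNReal.ofReal ((f s - c) ^ 2) ∂(discount r) +
          ∫⁻ s in Ici t, ENNReal.ofReal (v s.toNNReal) ∂(discount r) := fun f c t hf ↦ by
    rw [← lintegral_add_right _ hvmR]
    exact lintegral_congr fun s ↦ ENNReal.ofReal_add (sq_nonneg _) (hv0 _)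
  have tail : ∀ t : ℝ≥0,
      ∫⁻ s in Ici (t : ℝ), ENNReal.ofReal (b s ^ 2 + v s.toNNReal) ∂(discount r) ≤
        ∫⁻ s in Ici (t : ℝ), meanLoss P θ A 0 s ∂(discount r) := fun t ↦ by
    have h1 := split b 0 t hbm
    have h2 := split g 0 t hgm
    simp only [sub_zero] at h1 h2
    rw [h1]
    refine (add_le_add_left (hbtail t t.2) _).trans ?_
    rw [← h2]
    exact lintegral_mono hg1
  have mono_v : ∀ (c : ℝ) (t : ℝ),
      ∫⁻ s in Ici t, ENNReal.ofReal ((b s - c) ^ 2 + v' s.toNNReal) ∂(discount r) ≤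
        ∫⁻ s in Ici t, ENNReal.ofReal ((b s - c) ^ 2 + v s.toNNReal) ∂(discount r) := fun c t ↦
    lintegral_mono fun s ↦ ENNReal.ofReal_le_ofReal (by linarith [hv'v s.toNNReal])
  have loss' : ∀ c, ∫⁻ s in Ici (0 : ℝ),
      meanLoss P θ (clockRule κ μ₀ X (fun s : ℝ≥0 ↦ b s) τ) c s ∂(discount r) =
        ∫⁻ s in Ici (0 : ℝ), ENNReal.ofReal ((b s - c) ^ 2 + v' s.toNNReal) ∂(discount r) :=
    fun c ↦ setLIntegral_congr_fun measurableSet_Ici fun s hs ↦ by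
      rw [hX.meanLoss_clockRule hτ hτt, ← hv'eq, Real.coe_toNNReal s hs]
  refine ⟨clockRule κ μ₀ X (fun s : ℝ≥0 ↦ b s) τ, hrule, ?_,
    ⟨fun s ↦ b s, v', fun t ↦ ⟨(hX.bias_postVar_clockRule hτ hτt t).1, ?_⟩⟩, ?_, ?_⟩
  · refine hX.isObedient_clockRule hr hτ hτt hv'eq hA'm hθm fun t ↦ ?_
    have hE' : ENNReal.ofReal (Real.exp (r * t)) ≠ 0 := by simp [Real.exp_pos]
    -- The constraint for `v` at times `s > t` gives the one for its right limit `v'` at `t`.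
    have hlim := setLIntegral_Ici_le_of_tendsto (r := r) (t := t)
      (f := fun s ↦ ENNReal.ofReal (b s ^ 2 + v' s.toNNReal))
      (G := fun s ↦ ENNReal.ofReal (Real.exp (-(r * s)) * ((σ ^ 2 + r * v s) / (r - 2 * κ))))
      (L := ENNReal.ofReal (Real.exp (-(r * t)) * ((σ ^ 2 + r * v' t) / (r - 2 * κ))))
      (fun s ↦ by
        have h1 := hX.lintegral_meanLoss_le_of_isObedient hr hκ hAm hθm hobed (hm s)
        have h2 := mono_v 0 s
        simp only [sub_zero] at h2
        refine (h2.trans (tail s)).trans ?_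
        rw [ENNReal.ofReal_mul (Real.exp_pos _).le]
        refine le_trans ?_ (mul_le_mul_right h1 _)
        rw [← mul_assoc, ← ENNReal.ofReal_mul (Real.exp_pos _).le, ← Real.exp_add]
        simp)
      (by
        refine ENNReal.tendsto_ofReal ?_
        have hvlim : Filter.Tendsto v (nhdsWithin t (Ioi t)) (nhds (v' t)) := by
          rw [show v = fun t : ℝ≥0 ↦ Real.exp (κ * t) ^ 2 * (S t - p t) from funext hvp]
          have h1 : Continuous fun t : ℝ≥0 ↦ Real.exp (κ * t) ^ 2 := by fun_prop
          exact (h1.continuousWithinAt (s := Ioi t) (x := t)).tendsto.mul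
            ((hSc'.continuousWithinAt (s := Ioi t) (x := t)).tendsto.sub (hp.tendsto_rightLim t))
        have h2 : Continuous fun t : ℝ≥0 ↦ Real.exp (-(r * t)) := by fun_prop
        exact (h2.continuousWithinAt (s := Ioi t) (x := t)).tendsto.mul
          (((hvlim.const_mul r).const_add _).div_const _))
    have hcongr : ∫⁻ s in Ici (t : ℝ),
          ENNReal.ofReal (b s.toNNReal ^ 2 + v' s.toNNReal) ∂(discount r) =
        ∫⁻ s in Ici (t : ℝ), ENNReal.ofReal (b s ^ 2 + v' s.toNNReal) ∂(discount r) :=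
      setLIntegral_congr_fun measurableSet_Ici fun s hs ↦ by
        rw [Real.coe_toNNReal s (t.2.trans hs)]
    rw [hcongr]
    refine (mul_le_mul_right hlim _).trans ?_
    rw [← ENNReal.ofReal_mul (Real.exp_pos _).le, ← mul_assoc, ← Real.exp_add]
    simp
  · filter_upwards [(hX.bias_postVar_clockRule (b := fun s : ℝ≥0 ↦ b s) hτ hτt t).2] with ω h
    rw [h, hv'eq]
  · rw [utility_eq hAm hθm hr, utility_eq hA'm hθm hr, EReal.neg_le_neg_iff,
      EReal.coe_ennreal_le_coe_ennreal_iff, loss']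
    refine (mono_v β 0).trans ?_
    have hsame : ∫⁻ s in Ici (0 : ℝ), ENNReal.ofReal ((b s - β) ^ 2) ∂(discount r) =
        ∫⁻ s in Ici (0 : ℝ), ENNReal.ofReal ((g s - β) ^ 2) ∂(discount r) := by
      have hr0 : (discount r).restrict (Ici 0) = discount r :=
        Measure.restrict_eq_self_of_ae_mem (ae_discount_nonneg r)
      have hφ : Measurable fun y : ℝ ↦ ENNReal.ofReal ((y - β) ^ 2) := by fun_prop
      rw [hr0, ← lintegral_map hφ hbm, hblaw, lintegral_map hφ hgm]
    rw [split b β 0 hbm, hsame, ← split g β 0 hgm]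
    exact lintegral_mono hg2
  · rw [receiverFlow_eq, utility_eq hAm hθm hr, utility_eq hA'm hθm hr, EReal.neg_le_neg_iff,
      EReal.coe_ennreal_le_coe_ennreal_iff, loss']
    refine (mono_v 0 0).trans ?_
    simpa only [sub_zero, NNReal.coe_zero] using tail 0
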